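/- **Theorem (Fluctuation Bound).** Let $G=(\mathcal V,E)$ be a finite simple graph with $V=|\mathcal V|$ vertices and all degrees at most $\Delta$ (for example a piece of the square lattice, $\Delta=4$), and let $D\ge 1$. Give each vertex $x$ the space $V_x=(\mathbb C^{D})^{\otimes \deg x}\otimes\mathbb C^{D}$ (one virtual leg per neighbour, one physical leg; so all bond dimensions $D_{xy}=d_x=D$), let $|V_x\rangle=U_x|0_x\rangle$ with independent Haar random unitaries $U_x$, and let $|\Psi\rangle=\big(\bigotimes_{xy\in E}\langle xy|\big)\big(\bigotimes_x|V_x\rangle\big)$ be the random PEPS, where $|xy\rangle=D^{-1/2}\sum_i|ii\rangle$. For a region $A\subseteq\mathcal V$ let $\rho_A$ be the (unnormalized) reduced density matrix of $|\Psi\rangle\langle\Psi|$ on the physical legs in $A$, and for an integer $n\ge2$ let $$S_n(A)=\frac1{1-n}\log\frac{\operatorname{Tr}\rho_A^n}{(\operatorname{Tr}\rho_A)^n}.$$ For $\Gamma,h:\mathcal V\to \mathrm{Sym}_n$ put $$\mathcal A^{(n)}[\Gamma;h]=-\log D\sum_{xy\in E}\big(\chi(\Gamma_x^{-1}\Gamma_y)-n\big)-\log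 D\sum_x\chi(\Gamma_x^{-1}h_x)+\sum_x\log\frac{(D_x+n-1)!}{(D_x-1)!},$$ where $D_x=D^{\deg x+1}$ and $\chi$ is the number of cycles (fixed points included). Let $h_1$ be the cyclic permutation $(1\cdots n)$ on $A$ and the identity elsewhere, let $h_0$ be the identity everywhere, let $Z^{(n),\infty}_{i}=\exp\big(-\min_\Gamma \mathcal A^{(n)}[\Gamma;h_i]\big)$ for $i=0,1$, and let $$S_n^\infty(A)=\frac1{1-n}\log\frac{Z_1^{(n),\infty}}{Z_0^{(n),\infty}}$$ be the infinite-bond-dimension (ground-state) value of the entropy. Write $|\partial B|$ for the number of edges between $B$ and its complement. For every $n\ge 2$, $\Delta$ and $\theta<1$ there is a constant $c_n=c(n,\Delta,\theta)>0$, independent of $G$, $A$, $D$ and $\delta$, such that the following holds for all $G$ and $D$ as above, all $0<\delta\le 2$, and all regions $A$ with small surface-to-volume ratio in the sense that $$|\partial A|-|\partial B|\le\theta\,|A\,\triangle\,B|\qquad\text{for every } B\subseteq\mathcal V:$$ $$\Pr\big(|S_n(A)-S_n^{\infty}(A)|\le\delta\big)\ \ge\ 1-\frac{32}{\delta^2}\Big(e^{c_nV/D}-1\Big).$$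 In particular a bond dimension that grows polynomially (linearly, times $\delta^{-2}$) with $V$ suffices for high probability. -/

import Mathlib

open MeasureTheory

noncomputable section

namespace RandomPEPS

/-! ### Haar measure on the unitary group of a finite-dimensional space -/

instance unitaryGroup_compactSpace (ι : Type*) [Fintype ι] [DecidableEq ι] :
    CompactSpace (Matrix.unitaryGroup ι ℂ) := by
  have hsub : (Matrix.unitaryGroup ι ℂ : Set (Matrix ι ι ℂ)) ⊆
      Set.pi Set.univ fun _ => Set.pi Set.univ fun _ => Metric.closedBall (0 : ℂ) 1 := by
    intro U hU i _ j _
    simpa using entry_norm_bound_of_unitary hU i j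
  have hK : IsCompact (Set.pi Set.univ fun _ : ι => Set.pi Set.univ fun _ : ι =>
      Metric.closedBall (0 : ℂ) 1) :=
    isCompact_univ_pi fun _ => isCompact_univ_pi fun _ => isCompact_closedBall _ _
  have hclosed : IsClosed (Matrix.unitaryGroup ι ℂ : Set (Matrix ι ι ℂ)) := by
    have : (Matrix.unitaryGroup ι ℂ : Set (Matrix ι ι ℂ)) = {U | U * star U = 1} := by
      ext U
      exact Matrix.mem_unitaryGroup_iff
    rw [this]
    exact isClosed_eq (continuous_id.mul continuous_id.star) continuous_const
  exact isCompact_iff_compactSpace.mp (hK.of_isClosed_subset hclosed hsub)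

instance unitaryGroup_measurableSpace (ι : Type*) [Fintype ι] [DecidableEq ι] :
    MeasurableSpace (Matrix.unitaryGroup ι ℂ) := borel _

instance unitaryGroup_borelSpace (ι : Type*) [Fintype ι] [DecidableEq ι] :
    BorelSpace (Matrix.unitaryGroup ι ℂ) := ⟨rfl⟩

/-- The Haar measure of total mass one on the unitary group. -/
def haarUnitary (ι : Type*) [Fintype ι] [DecidableEq ι] : Measure (Matrix.unitaryGroup ι ℂ) :=
  Measure.haarMeasure ⊤

instance haarUnitary_isProbabilityMeasure (ι : Type*) [Fintype ι] [DecidableEq ι] :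
    IsProbabilityMeasure (haarUnitary ι) := by
  constructor
  have h := Measure.haarMeasure_self
    (K₀ := (⊤ : TopologicalSpace.PositiveCompacts (Matrix.unitaryGroup ι ℂ)))
  simpa [haarUnitary] using h

/-! ### The random tensor network state -/

section State

variable {V : Type*} [Fintype V] [DecidableEq V] (G : SimpleGraph V) [DecidableRel G.Adj] (D : ℕ)

/-- Labels of the product basis of the space of the vertex `x`: one virtual leg of dimension `D`
for each neighbour of `x`, and one physical (dangling) leg of dimension `D`. -/
abbrev VertexIndex (x : V) : Type _ := (G.neighborSet x → Fin D) × Fin D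

/-- One unitary for each vertex. -/
abbrev Sample : Type _ := ∀ x : V, Matrix.unitaryGroup (VertexIndex G D x) ℂ

/-- Independent Haar distributed unitaries at the vertices. -/
def sampleMeasure : Measure (Sample G D) :=
  Measure.pi fun x => haarUnitary (VertexIndex G D x)

variable [NeZero D]

/-- The random vertex state: the unitary at `x` applied to a reference basis vector. -/
def vertexState (U : Sample G D) (x : V) (i : VertexIndex G D x) : ℂ :=
  (U x : Matrix (VertexIndex G D x) (VertexIndex G D x) ℂ) i (fun _ => 0, 0)

/-- The (unnormalized) network state in the physical basis: the virtual legs at the two ends of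
each edge are projected onto the maximally entangled state `D ^ (-1/2) ∑ i, |i i⟩`. -/
def pepsState (U : Sample G D) (p : V → Fin D) : ℂ :=
  (((Real.sqrt D)⁻¹ ^ G.edgeFinset.card : ℝ) : ℂ) *
    ∑ e : G.edgeSet → Fin D,
      ∏ x, vertexState G D U x (fun y => e ⟨s(x, y), y.2⟩, p x)

/-- The physical configuration equal to `a` on `A` and to `b` on the complement of `A`. -/
def glue {D : ℕ} (A : Finset V) (a : {x // x ∈ A} → Fin D) (b : {x // x ∉ A} → Fin D) :
    V → Fin D :=
  fun x => if h : x ∈ A then a ⟨x, h⟩ else b ⟨x, h⟩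

/-- The (unnormalized) reduced density matrix of the region `A`. -/
def reducedDensity (U : Sample G D) (A : Finset V) :
    Matrix ({x // x ∈ A} → Fin D) ({x // x ∈ A} → Fin D) ℂ :=
  fun a a' => ∑ b : {x // x ∉ A} → Fin D,
    pepsState G D U (glue A a b) * star (pepsState G D U (glue A a' b))

/-- The `n`-th Rényi entropy `(1 - n)⁻¹ log (Tr ρ_A ^ n / (Tr ρ_A) ^ n)`. -/
def renyiEntropy (U : Sample G D) (A : Finset V) (n : ℕ) : ℝ :=
  (1 / (1 - (n : ℝ))) *
    Real.log (((reducedDensity G D U A) ^ n).trace / (reducedDensity G D U A).trace ^ n).re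

end State

/-! ### The permutation-valued spin model -/

section SpinModel

variable {V : Type*} [Fintype V] [DecidableEq V] (G : SimpleGraph V) [DecidableRel G.Adj]

/-- The number of cycles of a permutation, fixed points included. -/
def cycleCount {n : ℕ} (σ : Equiv.Perm (Fin n)) : ℕ :=
  Nat.card (Quotient (Equiv.Perm.SameCycle.setoid σ))

/-- The boundary field: the cyclic permutation of the `n` copies on `A`, the identity elsewhere. -/
def boundaryField (n : ℕ) (A : Finset V) (x : V) : Equiv.Perm (Fin n) :=
  if x ∈ A then finRotate n else 1

/-- The normalization `(D_x + n - 1)! / (D_x - 1)! = D_x (D_x + 1) ⋯ (D_x + n - 1)`, where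
`D_x = D ^ (deg x + 1)` is the dimension of the space of the vertex `x`. -/
def normConst (D n : ℕ) (x : V) : ℕ := (D ^ (G.degree x + 1)).ascFactorial n

/-- The action of a spin configuration `Γ` in the boundary field `h`. Each edge occurs twice in the
first sum, once from each end. -/
def action (D n : ℕ) (h Γ : V → Equiv.Perm (Fin n)) : ℝ :=
  -Real.log D *
      ((1 / 2) * ∑ x, ∑ y ∈ G.neighborFinset x, ((cycleCount ((Γ x)⁻¹ * Γ y) : ℝ) - n))
    - Real.log D * ∑ x, (cycleCount ((Γ x)⁻¹ * h x) : ℝ)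
    + ∑ x, Real.log (normConst G D n x)

/-- The least value of the action over all spin configurations. -/
def minAction (D n : ℕ) (h : V → Equiv.Perm (Fin n)) : ℝ :=
  ⨅ Γ : V → Equiv.Perm (Fin n), action G D n h Γ

/-- The large bond dimension form of a partition function: the weight of minimal action. -/
def groundWeight (D n : ℕ) (h : V → Equiv.Perm (Fin n)) : ℝ :=
  Real.exp (-minAction G D n h)

/-- The infinite bond dimension value of the `n`-th Rényi entropy: both partition functions are
replaced by their ground state weights. -/
def renyiEntropyInf (D n : ℕ) (A : Finset V) : ℝ :=
  (1 / (1 - (n : ℝ))) *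
    Real.log (groundWeight G D n (boundaryField n A) / groundWeight G D n (fun _ => 1))

/-- The number of edges between a region and its complement. -/
def surface (A : Finset V) : ℕ := (G.interedges A Aᶜ).card

/-- The surface-to-volume restriction on the region `A`: replacing `A` by any other region `B`
saves at most `θ` units of surface per unit of misaligned volume. -/
def SmallSurface (θ : ℝ) (A : Finset V) : Prop :=
  ∀ B : Finset V, (surface G A : ℝ) - surface G B ≤ θ * (symmDiff A B).card

end SpinModel

end RandomPEPS

end

/-! Both Tr ρ_A^n and (Tr ρ_A)^n are replica sums: n copies of the state contracted against n
conjugate copies, with the physical legs permuted by a field h (`replicaSum_finRotate`,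
`replicaSum_one`). Haar averaging pairs the copies at each vertex by a permutation
(`haarMoment_eq`), so the mean of a replica sum is the partition function of a permutation-valued
ferromagnet. In it Γ has weight D^(-energy) times a factor independent of Γ (`integral_replicaSum`).
The square of a replica sum is a replica sum on the doubled set R ⊕ R, so second moments are
partition functions of the same kind.

The small-surface condition makes the aligned configuration Γ = h the ground state, with excess
energy at least 1 - θ per unit of misalignment (`energy_gap`, with θ ≥ 0). This compares A with the
level sets of the distance of Γ to the identity, in the manner of a coarea formula.

Excess energy is additive over the connected components of the misaligned set, and it is a positive
integer on each. Hence each component costs D₀/D, and each misaligned vertex a factor small enough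
to beat both the choice of permutation and the growth of connected sets (`weight_le_of_components`).
Exploring the misaligned set one vertex at a time (`exploration_bound`) then bounds the relative
partition function by (1 + D₀/D)^V ≤ exp(D₀ V/D), which is `sum_excess_weight_le`.

Let X be a replica sum divided by its ground weight. Then E X ≥ 1, because the ground state is one
of the positive terms. Also E X² ≤ exp(cV/D), where the expansion is used only on the doubled
replicas and `weight_sumCongr_le` compares the two ground weights. So E (X - 1)² ≤ exp(cV/D) - 1,
and Markov's inequality for numerator and denominator at precision δ/4 gives the constant 16 + 16 =
32. -/

set_option linter.unusedSectionVars false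

noncomputable section

namespace RandomPEPS

/-! ### Counting cycles of permutations -/

section Orbits

open Equiv Equiv.Perm

variable {ι κ X : Type*}

/-- The number of cycles of a permutation of an arbitrary type, fixed points included. -/
def orbitCount (σ : Perm ι) : ℕ := Nat.card (Quotient (SameCycle.setoid σ))

theorem SameCycle.eq_of_invariant {σ : Perm ι} {f : ι → X} (hf : ∀ i, f (σ i) = f i) {i j : ι}
    (h : σ.SameCycle i j) : f i = f j := by
  obtain ⟨k, rfl⟩ := h
  induction k with
  | zero => simp
  | succ k ih =>
    rw [ih, add_comm, zpow_add, Perm.mul_apply, zpow_one, hf]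
  | pred k ih =>
    rw [ih, ← hf ((σ ^ (-(k : ℤ) - 1)) i), ← Perm.mul_apply, ← zpow_one_add]
    congr 3
    ring

/-- Functions invariant under a permutation are the functions on its set of cycles. -/
def invariantEquiv (σ : Perm ι) (X : Type*) :
    {f : ι → X // ∀ i, f (σ i) = f i} ≃ (Quotient (SameCycle.setoid σ) → X) where
  toFun f := Quotient.lift f.1 fun _ _ h => SameCycle.eq_of_invariant f.2 h
  invFun g := ⟨fun i => g (Quotient.mk _ i), fun i => congrArg g <| Quotient.sound <|
    (SameCycle.refl σ i).apply_left⟩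
  left_inv f := rfl
  right_inv g := by
    funext q
    induction q using Quotient.inductionOn
    rfl

theorem card_invariant [Finite ι] (σ : Perm ι) (X : Type*) :
    Nat.card {f : ι → X // ∀ i, f (σ i) = f i} = Nat.card X ^ orbitCount σ := by
  rw [Nat.card_congr (invariantEquiv σ X), Nat.card_fun, orbitCount]

/-- Replacing f by f ∘ σ turns coincidence into invariance under σ⁻¹ * τ. -/
theorem card_coincident [Finite ι] (σ τ : Perm ι) (X : Type*) :
    Nat.card {f : ι → X // ∀ i, f (σ i) = f (τ i)} = Nat.card X ^ orbitCount (σ⁻¹ * τ) := by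
  rw [← card_invariant]
  refine Nat.card_congr ((Equiv.arrowCongr σ⁻¹ (Equiv.refl X)).subtypeEquiv fun f => ?_)
  refine forall_congr' fun i => ?_
  change _ ↔ f (σ (σ.symm (τ i))) = f (σ i)
  rw [Equiv.apply_symm_apply]
  exact eq_comm

/-- A permutation with c cycles has 2 ^ c invariant Boolean colourings, so cycle counts can be
compared by counting colourings. -/
theorem orbitCount_eq_of_card [Finite ι] [Finite κ] {σ : Perm ι} {τ : Perm κ}
    (e : {f : ι → Bool // ∀ i, f (σ i) = f i} ≃ {f : κ → Bool // ∀ i, f (τ i) = f i}) :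
    orbitCount σ = orbitCount τ := by
  have h := Nat.card_congr e
  rw [card_invariant, card_invariant, Nat.card_eq_fintype_card, Fintype.card_bool] at h
  exact Nat.pow_right_injective le_rfl h

theorem orbitCount_inv [Finite ι] (σ : Perm ι) : orbitCount σ⁻¹ = orbitCount σ := by
  refine orbitCount_eq_of_card (Equiv.subtypeEquivRight fun f => ⟨fun h i => ?_, fun h i => ?_⟩)
  · rw [← h (σ i), Perm.inv_def, Equiv.symm_apply_apply]
  · rw [← h (σ⁻¹ i), Perm.inv_def, Equiv.apply_symm_apply]

theorem orbitCount_one [Finite ι] : orbitCount (1 : Perm ι) = Nat.card ι := by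
  have h := card_invariant (1 : Perm ι) Bool
  rw [Nat.card_congr (Equiv.subtypeUnivEquiv (p := fun f : ι → Bool =>
    ∀ i, f ((1 : Perm ι) i) = f i) fun f i => rfl), Nat.card_fun,
    Nat.card_eq_fintype_card, Fintype.card_bool] at h
  exact (Nat.pow_right_injective le_rfl h).symm

theorem orbitCount_le [Finite ι] (σ : Perm ι) : orbitCount σ ≤ Nat.card ι :=
  Nat.card_le_card_of_surjective _ Quotient.mk_surjective

theorem eq_one_of_orbitCount [Finite ι] {σ : Perm ι} (h : orbitCount σ = Nat.card ι) : σ = 1 := by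
  have hb := (Function.Surjective.bijective_of_nat_card_le
    (f := Quotient.mk (SameCycle.setoid σ)) Quotient.mk_surjective h.ge).injective
  ext i
  exact hb (Quotient.sound (SameCycle.refl σ i).apply_left)

theorem orbitCount_sumCongr [Finite ι] [Finite κ] (σ : Perm ι) (τ : Perm κ) :
    orbitCount (Perm.sumCongr σ τ) = orbitCount σ + orbitCount τ := by
  have h : Nat.card {f : ι ⊕ κ → Bool // ∀ i, f (Perm.sumCongr σ τ i) = f i} =
      Nat.card ({f : ι → Bool // ∀ i, f (σ i) = f i} × {f : κ → Bool // ∀ i, f (τ i) = f i}) := by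
    refine Nat.card_congr (((Equiv.sumArrowEquivProdArrow ι κ Bool).subtypeEquiv fun f => ?_).trans
      Equiv.subtypeProdEquivProd)
    simp [Sum.forall]
  rw [Nat.card_prod, card_invariant, card_invariant, card_invariant, ← pow_add,
    Nat.card_eq_fintype_card, Fintype.card_bool] at h
  exact Nat.pow_right_injective le_rfl h

/-! ### Cycle counts as dimensions, and the Cayley metric. -/

/-- The functions invariant under a permutation, as a subspace. -/
def invariantSubspace (σ : Perm ι) : Submodule ℚ (ι → ℚ) where
  carrier := {f | ∀ i, f (σ i) = f i}
  add_mem' hf hg i := by simp [hf i, hg i]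
  zero_mem' i := rfl
  smul_mem' c f hf i := by simp [hf i]

theorem finrank_invariantSubspace [Finite ι] (σ : Perm ι) :
    Module.finrank ℚ (invariantSubspace σ) = orbitCount σ := by
  have e : invariantSubspace σ ≃ₗ[ℚ] (Quotient (SameCycle.setoid σ) → ℚ) :=
    { invariantEquiv σ ℚ with
      map_add' := fun f g => by
        funext q
        induction q using Quotient.inductionOn
        rfl
      map_smul' := fun c f => by
        funext q
        induction q using Quotient.inductionOn
        rfl }
  have := Fintype.ofFinite (Quotient (SameCycle.setoid σ))
  rw [e.finrank_eq, Module.finrank_fintype_fun_eq_card, orbitCount, Nat.card_eq_fintype_card]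

/-- Dimension formula: functions fixed by both σ and τ are fixed by σ * τ, and the sum of the two
invariant subspaces has dimension at most `Nat.card ι`. This is the triangle inequality for
`permDist`. -/
theorem orbitCount_add_le [Finite ι] (σ τ : Perm ι) :
    orbitCount σ + orbitCount τ ≤ Nat.card ι + orbitCount (σ * τ) := by
  have := Fintype.ofFinite ι
  have h := Submodule.finrank_sup_add_finrank_inf_eq (invariantSubspace σ) (invariantSubspace τ)
  have h1 : Module.finrank ℚ ↥(invariantSubspace σ ⊓ invariantSubspace τ) ≤ orbitCount (σ * τ) := by
    rw [← finrank_invariantSubspace]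
    refine Submodule.finrank_mono fun f hf i => ?_
    rw [Perm.mul_apply, hf.1, hf.2]
  have h2 := Submodule.finrank_le (invariantSubspace σ ⊔ invariantSubspace τ)
  rw [Module.finrank_fintype_fun_eq_card, ← Nat.card_eq_fintype_card] at h2
  rw [finrank_invariantSubspace, finrank_invariantSubspace] at h
  omega

/-- The Cayley distance between permutations. -/
def permDist (σ τ : Perm ι) : ℕ := Nat.card ι - orbitCount (σ⁻¹ * τ)

theorem permDist_add_orbitCount [Finite ι] (σ τ : Perm ι) :
    permDist σ τ + orbitCount (σ⁻¹ * τ) = Nat.card ι :=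
  Nat.sub_add_cancel (orbitCount_le _)

theorem permDist_self [Finite ι] (σ : Perm ι) : permDist σ σ = 0 := by
  simp [permDist, orbitCount_one]

theorem permDist_comm [Finite ι] (σ τ : Perm ι) : permDist σ τ = permDist τ σ := by
  rw [permDist, permDist, ← orbitCount_inv, mul_inv_rev, inv_inv]

theorem permDist_pos [Finite ι] {σ τ : Perm ι} (h : σ ≠ τ) : 0 < permDist σ τ := by
  by_contra h0
  have h1 := permDist_add_orbitCount σ τ
  exact h (inv_mul_eq_one.1 (eq_one_of_orbitCount (by omega)))

theorem permDist_triangle [Finite ι] (σ τ ρ : Perm ι) :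
    permDist σ ρ ≤ permDist σ τ + permDist τ ρ := by
  have h := orbitCount_add_le (σ⁻¹ * τ) (τ⁻¹ * ρ)
  rw [mul_assoc, mul_inv_cancel_left] at h
  have h1 := permDist_add_orbitCount σ τ
  have h2 := permDist_add_orbitCount τ ρ
  have h3 := permDist_add_orbitCount σ ρ
  omega

end Orbits

/-! ### Moments of a Haar random unit vector -/

section Haar

variable {ι : Type*} [Fintype ι] [DecidableEq ι]

instance haarUnitary_isMulLeftInvariant : (haarUnitary ι).IsMulLeftInvariant := by
  unfold haarUnitary
  infer_instance

theorem continuous_unitary_entry (i j : ι) :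
    Continuous fun U : Matrix.unitaryGroup ι ℂ => (U : Matrix ι ι ℂ) i j :=
  (continuous_apply_apply i j).comp continuous_subtype_val

theorem integrable_haarUnitary {f : Matrix.unitaryGroup ι ℂ → ℂ} (hf : Continuous f) :
    Integrable f (haarUnitary ι) :=
  hf.integrable_of_hasCompactSupport (HasCompactSupport.of_compactSpace f)

theorem norm_column (U : Matrix.unitaryGroup ι ℂ) (o : ι) :
    ∑ j, (U : Matrix ι ι ℂ) j o * star ((U : Matrix ι ι ℂ) j o) = 1 := by
  have h := congrFun (congrFun (Matrix.mem_unitaryGroup_iff'.1 U.2) o) o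
  simpa [Matrix.mul_apply, mul_comm] using h

open Matrix in
theorem exp_mem_unitaryGroup {X : Matrix ι ι ℂ} (hX : Xᴴ = -X) :
    NormedSpace.exp X ∈ Matrix.unitaryGroup ι ℂ := by
  rw [Matrix.mem_unitaryGroup_iff', Matrix.star_eq_conjTranspose, ← Matrix.exp_conjTranspose, hX,
    ← Matrix.exp_add_of_commute _ _ (Commute.refl X).neg_left, neg_add_cancel, NormedSpace.exp_zero]

open Matrix in
/-- The one parameter group of unitaries generated by a Hermitian matrix. -/
theorem exists_unitary_flow (H : Matrix ι ι ℂ) (hH : H.IsHermitian) :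
    ∃ W : ℝ → Matrix.unitaryGroup ι ℂ, W 0 = 1 ∧ ∀ t i j,
      HasDerivAt (fun t => (W t : Matrix ι ι ℂ) i j)
        (Complex.I * ((H * (W t : Matrix ι ι ℂ)) i j)) t := by
  have hs : ∀ t : ℝ, (t • (Complex.I • H))ᴴ = -(t • (Complex.I • H)) := fun t => by
    rw [conjTranspose_smul, conjTranspose_smul, hH.eq]
    simp
  refine ⟨fun t => ⟨NormedSpace.exp (t • (Complex.I • H)), exp_mem_unitaryGroup (hs t)⟩, ?_,
    fun t i j => ?_⟩
  · ext1
    simp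
  -- The derivative of the exponential needs some algebra norm; entrywise differentiability does not
  -- depend on which one is chosen.
  · let _ : NormedRing (Matrix ι ι ℂ) := Matrix.linftyOpNormedRing
    let _ : NormedAlgebra ℝ (Matrix ι ι ℂ) := Matrix.linftyOpNormedAlgebra
    have h := hasDerivAt_exp_smul_const' (𝕂 := ℝ) (Complex.I • H) t
    have h2 := (hasDerivAt_pi.1 ((hasDerivAt_pi.1 h) i)) j
    rw [smul_mul] at h2
    exact h2

/-- Differentiation of an integral over a compact probability space. -/
theorem hasDerivAt_integral_of_continuous {K : Type*} [TopologicalSpace K] [CompactSpace K]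
    [MeasurableSpace K] [BorelSpace K] (μ : Measure K) [IsFiniteMeasure μ] (F F' : ℝ → K → ℂ)
    (hF : ∀ t, Continuous (F t)) (hF' : Continuous fun p : ℝ × K => F' p.1 p.2)
    (h : ∀ t x, HasDerivAt (fun t => F t x) (F' t x) t) (t : ℝ) :
    HasDerivAt (fun t => ∫ x, F t x ∂μ) (∫ x, F' t x ∂μ) t := by
  obtain ⟨C, hC⟩ := ((isCompact_Icc (a := t - 1) (b := t + 1)).prod
    (isCompact_univ (X := K))).exists_bound_of_continuousOn hF'.continuousOn
  have hc : Continuous (F' t) := hF'.comp (Continuous.prodMk_right t)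
  refine (hasDerivAt_integral_of_dominated_loc_of_deriv_le (F := F) (F' := F')
    (bound := fun _ => C) (Icc_mem_nhds (show t - 1 < t by linarith) (show t < t + 1 by linarith))
    (Filter.Eventually.of_forall fun s => ?_) ?_ ?_ ?_ (integrable_const C) ?_).2
  · exact ((hF s).integrable_of_hasCompactSupport
      (HasCompactSupport.of_compactSpace _)).aestronglyMeasurable
  · exact (hF t).integrable_of_hasCompactSupport (HasCompactSupport.of_compactSpace _)
  · exact (hc.integrable_of_hasCompactSupport
      (HasCompactSupport.of_compactSpace _)).aestronglyMeasurable
  · exact Filter.Eventually.of_forall fun x s hs => hC (s, x) ⟨hs, Set.mem_univ x⟩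
  · exact Filter.Eventually.of_forall fun x s _ => h s x

/-! ### Integration by parts on the unitary group. -/

variable {m k : ℕ}

/-- The derivative of a monomial along a linear vector field in the holomorphic variables. -/
def holDeriv (A : Matrix ι ι ℂ) (α : Fin m → ι) (β : Fin k → ι) (w : ι → ℂ) : ℂ :=
  (∑ i, (∏ j ∈ Finset.univ.erase i, w (α j)) * ∑ l, A (α i) l * w l) * ∏ i, star (w (β i))

/-- The derivative of a monomial along a linear vector field in the antiholomorphic variables. -/
def antiholDeriv (A : Matrix ι ι ℂ) (α : Fin m → ι) (β : Fin k → ι) (w : ι → ℂ) : ℂ :=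
  (∏ i, w (α i)) *
    ∑ i, (∏ j ∈ Finset.univ.erase i, star (w (β j))) * ∑ l, A l (β i) * star (w l)

theorem continuous_holDeriv (A : Matrix ι ι ℂ) (α : Fin m → ι) (β : Fin k → ι) :
    Continuous (holDeriv A α β) := by
  unfold holDeriv
  fun_prop

theorem continuous_antiholDeriv (A : Matrix ι ι ℂ) (α : Fin m → ι) (β : Fin k → ι) :
    Continuous (antiholDeriv A α β) := by
  unfold antiholDeriv
  fun_prop

/-- A column of a unitary matrix. -/
def column (o : ι) (U : Matrix.unitaryGroup ι ℂ) (j : ι) : ℂ := (U : Matrix ι ι ℂ) j o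

theorem continuous_column (o : ι) : Continuous (column o) :=
  continuous_pi fun j => continuous_unitary_entry j o

/-- Left invariance under exp(itH) makes the integral of a monomial constant in t. Its derivative at
0 is i times the difference of the two sides. -/
theorem integral_deriv_of_isHermitian (o : ι) (H : Matrix ι ι ℂ) (hH : H.IsHermitian)
    (α : Fin m → ι) (β : Fin k → ι) :
    ∫ U, holDeriv H α β (column o U) ∂haarUnitary ι =
      ∫ U, antiholDeriv H α β (column o U) ∂haarUnitary ι := by
  obtain ⟨W, hW0, hW⟩ := exists_unitary_flow H hH
  let w : ℝ → Matrix.unitaryGroup ι ℂ → ι → ℂ := fun t U => column o (W t * U)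
  have hw : ∀ t U i, HasDerivAt (fun t => w t U i) (Complex.I * ∑ l, H i l * w t U l) t := by
    intro t U i
    have h : HasDerivAt (fun t => ∑ l, (W t : Matrix ι ι ℂ) i l * (U : Matrix ι ι ℂ) l o)
        (∑ l, (Complex.I * ((H * (W t : Matrix ι ι ℂ)) i l)) * (U : Matrix ι ι ℂ) l o) t :=
      HasDerivAt.fun_sum fun l _ => (hW t i l).mul_const _
    refine HasDerivAt.congr_deriv h ?_
    have : ∑ l, H i l * w t U l = (H * ((W t : Matrix ι ι ℂ) * (U : Matrix ι ι ℂ))) i o := rfl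
    rw [this, ← Matrix.mul_assoc, Matrix.mul_apply, Finset.mul_sum]
    simp only [mul_assoc]
  have hws : ∀ t U i, HasDerivAt (fun t => star (w t U i))
      (-Complex.I * ∑ l, H l i * star (w t U l)) t := by
    intro t U i
    have h := (hw t U i).star
    refine HasDerivAt.congr_deriv h ?_
    rw [star_mul', star_sum]
    simp only [star_mul', Complex.star_def, Complex.conj_I]
    congr 1
    refine Finset.sum_congr rfl fun l _ => ?_
    rw [← hH.apply l i]
    simp
  have hWc : Continuous W := by
    refine Continuous.subtype_mk (continuous_matrix fun i j => ?_) _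
    exact continuous_iff_continuousAt.2 fun t => (hW t i j).continuousAt
  have hwc : Continuous fun p : ℝ × Matrix.unitaryGroup ι ℂ => w p.1 p.2 :=
    (continuous_column o).comp ((hWc.comp continuous_fst).mul continuous_snd)
  have hder := hasDerivAt_integral_of_continuous (haarUnitary ι)
    (fun t U => (∏ i, w t U (α i)) * ∏ i, star (w t U (β i)))
    (fun t U => Complex.I * (holDeriv H α β (w t U) - antiholDeriv H α β (w t U)))
    (fun t => ?_) ?_ (fun t U => ?_) 0
  · have hconst : ∀ t, ∫ U, (∏ i, w t U (α i)) * ∏ i, star (w t U (β i)) ∂haarUnitary ι =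
        ∫ U, (∏ i, column o U (α i)) * ∏ i, star (column o U (β i)) ∂haarUnitary ι := fun t =>
      integral_mul_left_eq_self
        (fun U => (∏ i, column o U (α i)) * ∏ i, star (column o U (β i))) (W t)
    simp only [hconst] at hder
    have h0 := hder.unique (hasDerivAt_const _ _)
    have hw0 : ∀ U, w 0 U = column o U := fun U => by simp only [w, hW0, one_mul]
    simp only [hw0] at h0
    rw [integral_const_mul, integral_sub
      (f := fun U => holDeriv H α β (column o U)) (g := fun U => antiholDeriv H α β (column o U))
      (integrable_haarUnitary ((continuous_holDeriv H α β).comp (continuous_column o)))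
      (integrable_haarUnitary
        ((continuous_antiholDeriv H α β).comp (continuous_column o)))] at h0
    exact sub_eq_zero.1 ((mul_eq_zero.1 h0).resolve_left Complex.I_ne_zero)
  · have : Continuous (w t) := hwc.comp (Continuous.prodMk_right t)
    fun_prop
  · exact continuous_const.mul
      (((continuous_holDeriv H α β).comp hwc).sub ((continuous_antiholDeriv H α β).comp hwc))
  · have h := (HasDerivAt.fun_finsetProd (u := Finset.univ) fun i _ => hw t U (α i)).mul
      (HasDerivAt.fun_finsetProd (u := Finset.univ) fun i _ => hws t U (β i))
    refine HasDerivAt.congr_deriv h ?_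
    simp only [holDeriv, antiholDeriv, smul_eq_mul, Finset.sum_mul, Finset.mul_sum, mul_sub]
    rw [sub_eq_add_neg, ← Finset.sum_neg_distrib]
    congr 1
    · refine Finset.sum_congr rfl fun i _ => Finset.sum_congr rfl fun l _ => ?_
      ring
    · refine Finset.sum_congr rfl fun i _ => ?_
      rw [← Finset.sum_neg_distrib]
      refine Finset.sum_congr rfl fun l _ => ?_
      ring

/-- Both sides are complex linear in A, and every matrix is X + iY with X and Y Hermitian. The
extension makes matrix units admissible. -/
theorem integral_deriv (o : ι) (A : Matrix ι ι ℂ) (α : Fin m → ι) (β : Fin k → ι) :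
    ∫ U, holDeriv A α β (column o U) ∂haarUnitary ι =
      ∫ U, antiholDeriv A α β (column o U) ∂haarUnitary ι := by
  have h1 : ∀ (X Y : Matrix ι ι ℂ) w, holDeriv (X + Complex.I • Y) α β w =
      holDeriv X α β w + Complex.I * holDeriv Y α β w := by
    intro X Y w
    simp only [holDeriv, Matrix.add_apply, Matrix.smul_apply, smul_eq_mul, add_mul,
      Finset.sum_add_distrib, mul_add, mul_assoc, ← Finset.mul_sum]
    simp only [mul_left_comm _ Complex.I, ← Finset.mul_sum]
    ring
  have h2 : ∀ (X Y : Matrix ι ι ℂ) w, antiholDeriv (X + Complex.I • Y) α β w =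
      antiholDeriv X α β w + Complex.I * antiholDeriv Y α β w := by
    intro X Y w
    simp only [antiholDeriv, Matrix.add_apply, Matrix.smul_apply, smul_eq_mul, add_mul,
      Finset.sum_add_distrib, mul_add, mul_assoc, ← Finset.mul_sum]
    simp only [mul_left_comm _ Complex.I, ← Finset.mul_sum]
  have hi : ∀ X : Matrix ι ι ℂ,
      Integrable (fun U => holDeriv X α β (column o U)) (haarUnitary ι) := fun X =>
    integrable_haarUnitary ((continuous_holDeriv X α β).comp (continuous_column o))
  have hj : ∀ X : Matrix ι ι ℂ,
      Integrable (fun U => antiholDeriv X α β (column o U)) (haarUnitary ι) := fun X =>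
    integrable_haarUnitary ((continuous_antiholDeriv X α β).comp (continuous_column o))
  rw [← realPart_add_I_smul_imaginaryPart A]
  simp only [h1, h2]
  rw [integral_add (hi _) ((hi _).const_mul _), integral_add (hj _) ((hj _).const_mul _),
    integral_const_mul, integral_const_mul,
    integral_deriv_of_isHermitian o _ (realPart A).2, integral_deriv_of_isHermitian o _
      (imaginaryPart A).2]

theorem sum_prod_erase_succ {R : Type*} [CommSemiring R] (f g : Fin (m + 1) → R) :
    ∑ i, (∏ j ∈ Finset.univ.erase i, f j) * g i =
      (∏ j : Fin m, f j.succ) * g 0 +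
        f 0 * ∑ i : Fin m, (∏ j ∈ Finset.univ.erase i, f j.succ) * g i.succ := by
  rw [Fin.sum_univ_succ, Finset.mul_sum]
  congr 1
  · have : (Finset.univ : Finset (Fin (m + 1))).erase 0 = Finset.univ.map (Fin.succEmb m) := by
      ext j
      cases j using Fin.cases <;> simp
    rw [this, Finset.prod_map]
    rfl
  · refine Finset.sum_congr rfl fun i _ => ?_
    have : (Finset.univ : Finset (Fin (m + 1))).erase i.succ =
        insert 0 ((Finset.univ.erase i).map (Fin.succEmb m)) := by
      ext j
      cases j using Fin.cases with
      | zero => simp [(Fin.succ_ne_zero i).symm]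
      | succ j => simp [Fin.succ_ne_zero]
    rw [this, Finset.prod_insert (by simp [Fin.succ_ne_zero]), Finset.prod_map, mul_assoc]
    rfl

/-- The complement of i is enumerated by `swap 0 i ∘ succ` because `Equiv.Perm.decomposeFin` uses
this form, which lets the moment recursion match the sum over permutations. -/
theorem prod_erase_eq_prod_swap {R : Type*} [CommMonoid R] (f : Fin (m + 1) → R)
    (i : Fin (m + 1)) :
    ∏ j ∈ Finset.univ.erase i, f j = ∏ j : Fin m, f (Equiv.swap 0 i j.succ) := by
  have : (Finset.univ : Finset (Fin (m + 1))).erase i =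
      Finset.univ.map ((Fin.succEmb m).trans (Equiv.swap 0 i).toEmbedding) := by
    ext j
    simp only [Finset.mem_erase, Finset.mem_univ, and_true, Finset.mem_map, true_and,
      Function.Embedding.trans_apply, Equiv.coe_toEmbedding, Fin.coe_succEmb]
    constructor
    · intro h
      have h0 : Equiv.swap 0 i j ≠ 0 := fun h0 => h <| by
        rw [Equiv.swap_apply_eq_iff, Equiv.swap_apply_left] at h0
        exact h0
      obtain ⟨l, hl⟩ := Fin.exists_succ_eq.2 h0
      exact ⟨l, by rw [hl, Equiv.swap_apply_self]⟩
    · rintro ⟨l, rfl⟩ h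
      rw [Equiv.swap_apply_eq_iff, Equiv.swap_apply_right] at h
      exact Fin.succ_ne_zero l h
  rw [this, Finset.prod_map]
  rfl

/-- Differentiating the extra factor `w j` gives `w k` for every j, hence `Fintype.card ι` copies.
Each of the other m factors contributes one more copy, from j = `α i`. -/
theorem sum_holDeriv_cons (k : ι) (α : Fin m → ι) (β : Fin (m + 1) → ι) (w : ι → ℂ) :
    ∑ j, holDeriv (Matrix.single j k 1) (Fin.cons j α : Fin (m + 1) → ι) β w =
      (Fintype.card ι + m) * ((w k * ∏ i, w (α i)) * ∏ i, star (w (β i))) := by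
  have hs : ∀ j a : ι, ∑ l, Matrix.single j k (1 : ℂ) a l * w l = if j = a then w k else 0 := by
    intro j a
    rw [Finset.sum_eq_single k (fun l _ hl => by simp [hl.symm])
      (fun h => absurd (Finset.mem_univ _) h)]
    simp [Matrix.single_apply]
  simp only [holDeriv, hs]
  rw [← Finset.sum_mul]
  simp only [sum_prod_erase_succ, Fin.cons_zero, Fin.cons_succ, if_true]
  rw [Finset.sum_add_distrib, Finset.sum_const, Finset.card_univ, nsmul_eq_mul]
  have h2 : ∑ j, w j * ∑ i, (∏ l ∈ Finset.univ.erase i, w (α l)) * (if j = α i then w k else 0) =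
      m * ((∏ i, w (α i)) * w k) := by
    simp only [Finset.mul_sum]
    rw [Finset.sum_comm]
    have : ∀ i, ∑ j, w j * ((∏ l ∈ Finset.univ.erase i, w (α l)) * (if j = α i then w k else 0)) =
        (∏ i, w (α i)) * w k := by
      intro i
      rw [Finset.sum_eq_single (α i) (fun j _ hj => by simp [hj])
        (fun h => absurd (Finset.mem_univ _) h), if_pos rfl, ← mul_assoc,
        Finset.mul_prod_erase Finset.univ (fun l => w (α l)) (Finset.mem_univ i)]
    rw [Finset.sum_congr rfl fun i _ => this i, Finset.sum_const, Finset.card_univ,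
      Fintype.card_fin, nsmul_eq_mul]
  rw [h2]
  ring

/-- The factor `star (w j)` produced by the derivative meets the extra `w j`; summing over j uses up
the normalization of w and deletes one antiholomorphic factor. -/
theorem sum_antiholDeriv_cons (k : ι) (α : Fin m → ι) (β : Fin (m + 1) → ι) (w : ι → ℂ)
    (hw : ∑ j, w j * star (w j) = 1) :
    ∑ j, antiholDeriv (Matrix.single j k 1) (Fin.cons j α : Fin (m + 1) → ι) β w =
      ∑ i, if k = β i then
        (∏ l, w (α l)) * ∏ l : Fin m, star (w (β (Equiv.swap 0 i l.succ))) else 0 := by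
  have hs : ∀ j b : ι, ∑ l, Matrix.single j k (1 : ℂ) l b * star (w l) =
      if k = b then star (w j) else 0 := by
    intro j b
    rw [Finset.sum_eq_single j (fun l _ hl => by simp [hl.symm])
      (fun h => absurd (Finset.mem_univ _) h)]
    simp [Matrix.single_apply]
  simp only [antiholDeriv, hs, Fin.prod_univ_succ (n := m), Fin.cons_zero, Fin.cons_succ,
    prod_erase_eq_prod_swap, Finset.mul_sum]
  rw [Finset.sum_comm]
  refine Finset.sum_congr rfl fun i _ => ?_
  split_ifs
  · rw [← one_mul ((∏ l, w (α l)) * _), ← hw, Finset.sum_mul]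
    refine Finset.sum_congr rfl fun j _ => ?_
    ring
  · simp

/-- The mixed moments of a column of a Haar random unitary. -/
def haarMoment {R : Type*} [Fintype R] (o : ι) (α β : R → ι) : ℂ :=
  ∫ U, (∏ i, column o U (α i)) * ∏ i, star (column o U (β i)) ∂haarUnitary ι

theorem continuous_monomial {R : Type*} [Fintype R] (o : ι) (α β : R → ι) :
    Continuous fun U => (∏ i, column o U (α i)) * ∏ i, star (column o U (β i)) := by
  have := continuous_column (ι := ι) o
  fun_prop

/-- This is a Wick-type recursion: the integration by parts identity for the matrix units `single j
k 1`, summed over j. -/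
theorem haarMoment_cons (o k : ι) (α : Fin m → ι) (β : Fin (m + 1) → ι) :
    (Fintype.card ι + m) * haarMoment o (Fin.cons k α : Fin (m + 1) → ι) β =
      ∑ i, if k = β i then haarMoment o α (fun l => β (Equiv.swap 0 i l.succ)) else 0 := by
  have h1 : ∑ j, ∫ U, holDeriv (Matrix.single j k 1) (Fin.cons j α : Fin (m + 1) → ι) β
      (column o U) ∂haarUnitary ι = (Fintype.card ι + m) *
        haarMoment o (Fin.cons k α : Fin (m + 1) → ι) β := by
    rw [← integral_finsetSum (f := fun j U => holDeriv (Matrix.single j k 1)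
      (Fin.cons j α : Fin (m + 1) → ι) β (column o U)) _ fun j _ => integrable_haarUnitary
      ((continuous_holDeriv _ _ _).comp (continuous_column o)), haarMoment, ← integral_const_mul]
    simp only [sum_holDeriv_cons, Fin.prod_univ_succ (n := m), Fin.cons_zero, Fin.cons_succ]
  have h2 : ∑ j, ∫ U, antiholDeriv (Matrix.single j k 1) (Fin.cons j α : Fin (m + 1) → ι) β
      (column o U) ∂haarUnitary ι =
        ∑ i, if k = β i then haarMoment o α (fun l => β (Equiv.swap 0 i l.succ)) else 0 := by
    rw [← integral_finsetSum (f := fun j U => antiholDeriv (Matrix.single j k 1)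
      (Fin.cons j α : Fin (m + 1) → ι) β (column o U)) _ fun j _ => integrable_haarUnitary
      ((continuous_antiholDeriv _ _ _).comp (continuous_column o))]
    simp only [fun U => sum_antiholDeriv_cons k α β (column o U) (norm_column U o)]
    rw [integral_finsetSum _ fun i _ => ?_]
    · refine Finset.sum_congr rfl fun i _ => ?_
      split_ifs
      · rfl
      · simp
    · split_ifs
      · exact integrable_haarUnitary (continuous_monomial o _ _)
      · exact integrable_zero _ _ _
  rw [← h1, ← h2]
  exact Finset.sum_congr rfl fun j _ => integral_deriv o _ _ _

theorem haarMoment_fin (o : ι) (α β : Fin m → ι) :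
    ((Fintype.card ι).ascFactorial m : ℂ) * haarMoment o α β =
      ∑ π : Equiv.Perm (Fin m), ∏ i, if α i = β (π i) then 1 else 0 := by
  induction m with
  | zero => simp [haarMoment]
  | succ m ih =>
    rw [← Equiv.sum_comp Equiv.Perm.decomposeFin.symm, Fintype.sum_prod_type]
    simp only [Fin.prod_univ_succ (n := m), Equiv.Perm.decomposeFin_symm_apply_zero,
      Equiv.Perm.decomposeFin_symm_apply_succ, ← Finset.mul_sum]
    have h := haarMoment_cons o (α 0) (fun i => α i.succ) β
    have hα : (Fin.cons (α 0) (fun i => α i.succ) : Fin (m + 1) → ι) = α := by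
      ext i
      cases i using Fin.cases <;> rfl
    rw [hα] at h
    rw [Nat.ascFactorial_succ, Nat.cast_mul, Nat.cast_add, mul_right_comm, h, Finset.sum_mul]
    refine Finset.sum_congr rfl fun p _ => ?_
    rw [← ih (fun i => α i.succ) (fun l => β (Equiv.swap 0 p l.succ))]
    split_ifs <;> ring

theorem haarMoment_eq {R : Type*} [Fintype R] [DecidableEq R] (o : ι) (α β : R → ι) :
    haarMoment o α β = ((Fintype.card ι).ascFactorial (Fintype.card R) : ℂ)⁻¹ *
      ∑ π : Equiv.Perm R, if ∀ i, α (π i) = β i then 1 else 0 := by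
  have : Nonempty ι := ⟨o⟩
  have hN : ((Fintype.card ι).ascFactorial (Fintype.card R) : ℂ) ≠ 0 := by
    have h2 : 0 < Fintype.card ι ^ Fintype.card R := pow_pos Fintype.card_pos _
    exact_mod_cast (h2.trans_le (Nat.pow_succ_le_ascFactorial _ _)).ne'
  rw [eq_inv_mul_iff_mul_eq₀ hN]
  let e := Fintype.equivFin R
  have h := haarMoment_fin o (α ∘ e.symm) (β ∘ e.symm)
  have h1 : haarMoment o (α ∘ e.symm) (β ∘ e.symm) = haarMoment o α β := by
    simp only [haarMoment, Function.comp]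
    congr 1
    funext U
    rw [Equiv.prod_comp e.symm (fun i => column o U (α i)),
      Equiv.prod_comp e.symm (fun i => star (column o U (β i)))]
  rw [h1] at h
  rw [h, ← Equiv.sum_comp ((Equiv.inv _).trans e.permCongr)]
  refine Finset.sum_congr rfl fun π _ => ?_
  rw [← Fintype.prod_boole, ← Equiv.prod_comp (π.trans e)]
  simp

end Haar

/-! ### Exploration bound for separated sets -/

section Exploration

variable {V : Type*} [Fintype V] [DecidableEq V] (G : SimpleGraph V)

/-- A subset without edges to the rest of the set. -/
def IsSeparated (M C : Finset V) : Prop :=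
  C ⊆ M ∧ ∀ x ∈ C, ∀ y ∈ M, y ∉ C → ¬G.Adj x y

/-- The connected components of a set of vertices: its minimal separated subsets. -/
def IsComponent (M C : Finset V) : Prop :=
  IsSeparated G M C ∧ C.Nonempty ∧ ∀ P ⊆ C, P.Nonempty → IsSeparated G M P → P = C

open Classical in
/-- The components of a set which avoid another set. -/
def componentsAvoiding (M Q : Finset V) : Finset (Finset V) :=
  {C | IsComponent G M C ∧ Disjoint C Q}

variable {G}

theorem IsComponent.subset {M C : Finset V} (h : IsComponent G M C) : C ⊆ M := h.1.1

theorem mem_componentsAvoiding {M Q C : Finset V} :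
    C ∈ componentsAvoiding G M Q ↔ IsComponent G M C ∧ Disjoint C Q := by
  simp [componentsAvoiding]

theorem componentsAvoiding_empty (Q : Finset V) : componentsAvoiding G ∅ Q = ∅ := by
  refine Finset.eq_empty_of_forall_notMem fun C hC => ?_
  obtain ⟨h, -⟩ := mem_componentsAvoiding.1 hC
  exact h.2.1.ne_empty (Finset.subset_empty.1 h.subset)

theorem IsSeparated.sdiff {M C P : Finset V} (hC : IsSeparated G M C) (hP : IsSeparated G M P) :
    IsSeparated G M (C \ P) := by
  refine ⟨Finset.sdiff_subset.trans hC.1, fun x hx y hy hyn hadj => ?_⟩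
  rw [Finset.mem_sdiff] at hx hyn
  by_cases hyC : y ∈ C
  · have hyP : y ∈ P := by tauto
    exact hP.2 y hyP x (hC.1 hx.1) hx.2 hadj.symm
  · exact hC.2 x hx.1 y hy hyC hadj

theorem IsSeparated.inter {M C P : Finset V} (hC : IsSeparated G M C) (hP : IsSeparated G M P) :
    IsSeparated G M (C ∩ P) := by
  refine ⟨Finset.inter_subset_left.trans hC.1, fun x hx y hy hyn hadj => ?_⟩
  rw [Finset.mem_inter] at hx hyn
  by_cases hyC : y ∈ C
  · exact hP.2 x hx.2 y hy (fun h => hyn ⟨hyC, h⟩) hadj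
  · exact hC.2 x hx.1 y hy hyC hadj

/-- Take a smallest separated set containing x. A nonempty separated subset missing x could be
removed, leaving a smaller one. -/
theorem exists_isComponent_mem {M : Finset V} {x : V} (hx : x ∈ M) :
    ∃ C, IsComponent G M C ∧ x ∈ C := by
  classical
  let F : Finset (Finset V) := {C | IsSeparated G M C ∧ x ∈ C}
  have hF : F.Nonempty :=
    ⟨M, by simp only [F, Finset.mem_filter_univ]; exact ⟨⟨subset_rfl, by tauto⟩, hx⟩⟩
  obtain ⟨C, hC, hmin⟩ := F.exists_min_image Finset.card hF
  simp only [F, Finset.mem_filter_univ] at hC hmin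
  refine ⟨C, ⟨hC.1, ⟨x, hC.2⟩, fun P hPC hPne hP => ?_⟩, hC.2⟩
  by_cases hxP : x ∈ P
  · exact Finset.eq_of_subset_of_card_le hPC (hmin P ⟨hP, hxP⟩)
  · have h := hmin (C \ P) ⟨hC.1.sdiff hP, Finset.mem_sdiff.2 ⟨hC.2, hxP⟩⟩
    rw [Finset.card_sdiff_of_subset hPC] at h
    have h1 := hPne.card_pos
    have h2 := Finset.card_le_card hPC
    omega

theorem componentsAvoiding_erase_subset {M Q : Finset V} {y : V} (hy : y ∉ M) :
    componentsAvoiding G M (Q.erase y) ⊆ componentsAvoiding G M Q := by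
  intro C hC
  rw [mem_componentsAvoiding] at hC ⊢
  refine ⟨hC.1, Finset.disjoint_left.2 fun z hz hzQ => ?_⟩
  have hzy : z ≠ y := fun h => hy (h ▸ hC.1.subset hz)
  exact Finset.disjoint_left.1 hC.2 hz (Finset.mem_erase.2 ⟨hzy, hzQ⟩)

theorem isComponent_insert {M C : Finset V} {y : V} (hy : y ∉ M) (hC : IsComponent G M C)
    (hN : ∀ z ∈ C, ¬G.Adj y z) : IsComponent G (insert y M) C := by
  refine ⟨⟨hC.subset.trans (Finset.subset_insert _ _), fun x hx z hz hzC => ?_⟩, hC.2.1,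
    fun P hP hPne hPs => hC.2.2 P hP hPne ⟨hP.trans hC.subset, fun x hx z hz hzP =>
      hPs.2 x hx z (Finset.mem_insert_of_mem hz) hzP⟩⟩
  rcases Finset.mem_insert.1 hz with rfl | hz
  · exact fun h => hN x hx h.symm
  · exact hC.1.2 x hx z hz hzC

/-- Once the neighbours of y in S are put on the forbidden list R, the components avoiding R are
untouched by adding y. -/
theorem componentsAvoiding_subset_insert {M S Q : Finset V} {y : V} (hy : y ∉ M) (hMS : M ⊆ S)
    (R : Finset V) (hR : ∀ z ∈ S, G.Adj y z → z ∈ R) (hQ : Q.erase y ⊆ R) :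
    componentsAvoiding G M R ⊆ componentsAvoiding G (insert y M) Q := by
  intro C hC
  rw [mem_componentsAvoiding] at hC ⊢
  refine ⟨isComponent_insert hy hC.1 fun z hz hadj =>
    Finset.disjoint_left.1 hC.2 hz (hR z (hMS (hC.1.subset hz)) hadj),
    Finset.disjoint_left.2 fun z hz hzQ => Finset.disjoint_left.1 hC.2 hz (hQ ?_)⟩
  exact Finset.mem_erase.2 ⟨fun h => hy (h ▸ hC.1.subset hz), hzQ⟩

/-- The extra component is the one containing y itself. -/
theorem card_componentsAvoiding_insert {M S : Finset V} {y : V} (hy : y ∉ M) (hMS : M ⊆ S)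
    (R : Finset V) (hR : ∀ z ∈ S, G.Adj y z → z ∈ R) :
    (componentsAvoiding G M R).card + 1 ≤ (componentsAvoiding G (insert y M) ∅).card := by
  obtain ⟨C, hC, hyC⟩ := exists_isComponent_mem (G := G) (Finset.mem_insert_self y M)
  have hCn : C ∉ componentsAvoiding G M R := fun h =>
    hy ((mem_componentsAvoiding.1 h).1.subset hyC)
  rw [← Finset.card_insert_of_notMem hCn]
  refine Finset.card_le_card (Finset.insert_subset ?_
    (componentsAvoiding_subset_insert hy hMS R hR (by simp)))
  exact mem_componentsAvoiding.2 ⟨hC, Finset.disjoint_empty_right C⟩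

/-- Exploring a random set of vertices component by component. -/
theorem exploration_bound [DecidableRel G.Adj] {Δ : ℕ} (hΔ : ∀ x, G.degree x ≤ Δ) {a : ℝ}
    (ha : 0 ≤ a) (ha1 : a ≤ 1) (S Q : Finset V) (hQ : Q ⊆ S) :
    ∑ M ∈ S.powerset, ((2 : ℝ)⁻¹ ^ Δ) ^ M.card * a ^ (componentsAvoiding G M Q).card ≤
      (1 + a) ^ S.card * 2 ^ Q.card := by
  -- Q is the queue of vertices seen next to the explored part; components meeting Q have already
  -- been paid for. S holds the undecided vertices.
  induction hn : S.card generalizing S Q with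
  | zero =>
    rw [Finset.card_eq_zero] at hn
    subst hn
    rw [Finset.subset_empty] at hQ
    simp [hQ, componentsAvoiding_empty]
  | succ n ih =>
    have ht : (0 : ℝ) ≤ (2⁻¹ : ℝ) ^ Δ := by positivity
    have ht2 : (2⁻¹ : ℝ) ^ Δ * 2 ^ Δ = 1 := by rw [← mul_pow]; norm_num
    have hN : ∀ y, (G.neighborFinset y ∩ S.erase y).card ≤ Δ := fun y =>
      (Finset.card_le_card Finset.inter_subset_left).trans (hΔ y)
    rcases Q.eq_empty_or_nonempty with rfl | ⟨y, hyQ⟩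
    -- Empty queue: x is either absent, or opens a new component at price a. Its weight 2^(-Δ)
    -- cancels the factor 2^Δ from queueing at most Δ neighbours.
    · have hne : S.Nonempty := Finset.card_pos.1 (by omega)
      obtain ⟨x, hx⟩ := hne
      have hcard : (S.erase x).card = n := by rw [Finset.card_erase_of_mem hx, hn]; rfl
      conv_lhs => rw [← Finset.insert_erase hx]
      rw [Finset.sum_powerset_insert (Finset.notMem_erase x S)]
      have h1 := ih (S.erase x) ∅ (Finset.empty_subset _) hcard
      have h2 := ih (S.erase x) (G.neighborFinset x ∩ S.erase x) Finset.inter_subset_right hcard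
      have h3 : ∑ M ∈ (S.erase x).powerset, ((2 : ℝ)⁻¹ ^ Δ) ^ (insert x M).card *
          a ^ (componentsAvoiding G (insert x M) ∅).card ≤ (2⁻¹ : ℝ) ^ Δ * a *
          ∑ M ∈ (S.erase x).powerset, ((2 : ℝ)⁻¹ ^ Δ) ^ M.card *
            a ^ (componentsAvoiding G M (G.neighborFinset x ∩ S.erase x)).card := by
        rw [Finset.mul_sum]
        refine Finset.sum_le_sum fun M hM => ?_
        rw [Finset.mem_powerset] at hM
        have hxM : x ∉ M := fun h => Finset.notMem_erase x S (hM h)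
        have hc := card_componentsAvoiding_insert (G := G) hxM hM
          (G.neighborFinset x ∩ S.erase x) (fun z hz hadj => by simp_all)
        rw [Finset.card_insert_of_notMem hxM, pow_succ]
        calc _ ≤ ((2 : ℝ)⁻¹ ^ Δ) ^ M.card * (2 : ℝ)⁻¹ ^ Δ *
            a ^ ((componentsAvoiding G M (G.neighborFinset x ∩ S.erase x)).card + 1) := by
              gcongr ?_ * ?_
              exact pow_le_pow_of_le_one ha ha1 hc
          _ = _ := by ring
      have h4 : (2 : ℝ) ^ (G.neighborFinset x ∩ S.erase x).card ≤ 2 ^ Δ :=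
        pow_le_pow_right₀ (by norm_num) (hN x)
      calc _ ≤ (1 + a) ^ n * 2 ^ 0 + (2⁻¹ : ℝ) ^ Δ * a * ((1 + a) ^ n * 2 ^ Δ) := by
            refine add_le_add h1 (h3.trans ?_)
            refine mul_le_mul_of_nonneg_left (h2.trans ?_) (by positivity)
            gcongr
        _ = (1 + a) ^ n + a * (1 + a) ^ n * ((2⁻¹ : ℝ) ^ Δ * 2 ^ Δ) := by ring
        _ = _ := by rw [ht2, Finset.card_empty]; ring
    -- Nonempty queue: y leaves it whether or not y is in M. The two cases contribute equal bounds,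
    -- which together restore the factor 2 that y had in 2 ^ `Q.card`.
    · have hy := hQ hyQ
      have hcard : (S.erase y).card = n := by rw [Finset.card_erase_of_mem hy, hn]; rfl
      let R := Q.erase y ∪ (G.neighborFinset y ∩ S.erase y)
      have hQS : Q.erase y ⊆ S.erase y := Finset.erase_subset_erase y hQ
      have hRS : R ⊆ S.erase y := Finset.union_subset hQS Finset.inter_subset_right
      conv_lhs => rw [← Finset.insert_erase hy]
      rw [Finset.sum_powerset_insert (Finset.notMem_erase y S)]
      have h1 := ih (S.erase y) (Q.erase y) hQS hcard
      have h2 := ih (S.erase y) R hRS hcard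
      have h0 : ∑ M ∈ (S.erase y).powerset, ((2 : ℝ)⁻¹ ^ Δ) ^ M.card *
          a ^ (componentsAvoiding G M Q).card ≤
          ∑ M ∈ (S.erase y).powerset, ((2 : ℝ)⁻¹ ^ Δ) ^ M.card *
            a ^ (componentsAvoiding G M (Q.erase y)).card := by
        refine Finset.sum_le_sum fun M hM => ?_
        rw [Finset.mem_powerset] at hM
        have hyM : y ∉ M := fun h => Finset.notMem_erase y S (hM h)
        gcongr ?_ * ?_
        exact pow_le_pow_of_le_one ha ha1
          (Finset.card_le_card (componentsAvoiding_erase_subset hyM))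
      have h3 : ∑ M ∈ (S.erase y).powerset, ((2 : ℝ)⁻¹ ^ Δ) ^ (insert y M).card *
          a ^ (componentsAvoiding G (insert y M) Q).card ≤ (2⁻¹ : ℝ) ^ Δ *
          ∑ M ∈ (S.erase y).powerset, ((2 : ℝ)⁻¹ ^ Δ) ^ M.card *
            a ^ (componentsAvoiding G M R).card := by
        rw [Finset.mul_sum]
        refine Finset.sum_le_sum fun M hM => ?_
        rw [Finset.mem_powerset] at hM
        have hyM : y ∉ M := fun h => Finset.notMem_erase y S (hM h)
        have hc := Finset.card_le_card (componentsAvoiding_subset_insert (G := G) (Q := Q) hyM hM R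
          (fun z hz hadj => by simp_all [R]) Finset.subset_union_left)
        rw [Finset.card_insert_of_notMem hyM, pow_succ]
        calc _ ≤ ((2 : ℝ)⁻¹ ^ Δ) ^ M.card * (2 : ℝ)⁻¹ ^ Δ *
            a ^ (componentsAvoiding G M R).card := by
              gcongr ?_ * ?_
              exact pow_le_pow_of_le_one ha ha1 hc
          _ = _ := by ring
      have hQc : Q.card = (Q.erase y).card + 1 := (Finset.card_erase_add_one hyQ).symm
      have h4 : (2 : ℝ) ^ R.card ≤ 2 ^ ((Q.erase y).card + Δ) :=
        pow_le_pow_right₀ (by norm_num) ((Finset.card_union_le _ _).trans (by gcongr; exact hN y))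
      calc _ ≤ (1 + a) ^ n * 2 ^ (Q.erase y).card +
            (2⁻¹ : ℝ) ^ Δ * ((1 + a) ^ n * 2 ^ ((Q.erase y).card + Δ)) := by
            refine add_le_add (h0.trans h1) (h3.trans ?_)
            refine mul_le_mul_of_nonneg_left (h2.trans ?_) ht
            gcongr
        _ = (1 + a) ^ n * 2 ^ (Q.erase y).card * (1 + (2⁻¹ : ℝ) ^ Δ * 2 ^ Δ) := by ring
        _ = (1 + a) ^ n * 2 ^ Q.card := by rw [ht2, hQc]; ring
        _ ≤ _ := by
            gcongr ?_ * _
            exact pow_le_pow_right₀ (by linarith) (Nat.le_succ n)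

end Exploration

/-! ### Energies of permutation-valued configurations -/

section Energy

variable {V : Type*} [Fintype V] [DecidableEq V] (G : SimpleGraph V) [DecidableRel G.Adj]

theorem sum_sum_neighborFinset {M : Type*} [AddCommMonoid M] (f : Sym2 V → M) :
    ∑ x, ∑ y ∈ G.neighborFinset x, f s(x, y) = 2 • ∑ e ∈ G.edgeFinset, f e := by
  have h1 : ∑ d : G.Dart, f d.edge = 2 • ∑ e ∈ G.edgeFinset, f e := by
    rw [← Finset.sum_fiberwise_of_maps_to (t := G.edgeFinset) (g := SimpleGraph.Dart.edge)
      fun d _ => SimpleGraph.mem_edgeFinset.2 d.edge_mem, Finset.smul_sum]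
    refine Finset.sum_congr rfl fun e he => ?_
    rw [Finset.sum_congr rfl fun d hd => congrArg f (Finset.mem_filter.1 hd).2, Finset.sum_const,
      G.dart_edge_fiber_card e (SimpleGraph.mem_edgeFinset.1 he)]
  rw [← h1, Finset.sum_sigma']
  refine Finset.sum_bij' (fun p hp => ⟨(p.1, p.2), by simpa using hp⟩)
    (fun d _ => ⟨d.fst, d.snd⟩) ?_ ?_ ?_ ?_ ?_
  · simp
  · intro d _
    simp
  · simp
  · simp
  · intro p hp
    rfl

theorem surface_eq_sum (B : Finset V) :
    surface G B = ∑ x, ∑ y ∈ G.neighborFinset x, if x ∈ B ∧ y ∉ B then 1 else 0 := by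
  rw [surface, Finset.sum_sigma', Finset.sum_boole, Nat.cast_id]
  refine Finset.card_bij' (fun p _ => ⟨p.1, p.2⟩) (fun p _ => (p.1, p.2)) ?_ ?_ ?_ ?_
  · intro p hp
    rw [SimpleGraph.mem_interedges_iff] at hp
    simp at hp ⊢
    tauto
  · intro p hp
    rw [SimpleGraph.mem_interedges_iff]
    simp at hp ⊢
    tauto
  · intro p _; rfl
  · intro p _; rfl

theorem sum_neighbor_comm {M : Type*} [AddCommMonoid M] (f : V → V → M) :
    ∑ x, ∑ y ∈ G.neighborFinset x, f x y = ∑ x, ∑ y ∈ G.neighborFinset x, f y x := by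
  refine Finset.sum_comm' fun x y => ?_
  simp [G.adj_comm]

theorem two_mul_surface (B : Finset V) :
    2 * surface G B = ∑ x, ∑ y ∈ G.neighborFinset x, if (x ∈ B ↔ y ∈ B) then 0 else 1 := by
  rw [two_mul]
  nth_rewrite 2 [surface_eq_sum]
  rw [sum_neighbor_comm, surface_eq_sum, ← Finset.sum_add_distrib]
  refine Finset.sum_congr rfl fun x _ => ?_
  rw [← Finset.sum_add_distrib]
  refine Finset.sum_congr rfl fun y _ => ?_
  by_cases hx : x ∈ B <;> by_cases hy : y ∈ B <;> simp [hx, hy]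

/-! ### Energies, level sets and the stability of the aligned state. -/

variable {ι : Type*} [Finite ι]

/-- The distance of the permutations at the two ends of an edge. -/
def edgeDist (Γ : V → Equiv.Perm ι) (e : Sym2 V) : ℕ :=
  Sym2.lift ⟨fun x y => permDist (Γ x) (Γ y), fun x y => permDist_comm (Γ x) (Γ y)⟩ e

@[simp]
theorem edgeDist_mk (Γ : V → Equiv.Perm ι) (x y : V) :
    edgeDist Γ s(x, y) = permDist (Γ x) (Γ y) := rfl

/-- The energy of a configuration in a field. -/
def energy (h Γ : V → Equiv.Perm ι) : ℕ :=
  ∑ e ∈ G.edgeFinset, edgeDist Γ e + ∑ x, permDist (Γ x) (h x)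

theorem energy_self (h : V → Equiv.Perm ι) : energy G h h = ∑ e ∈ G.edgeFinset, edgeDist h e := by
  simp [energy, permDist_self]

theorem two_mul_energy (h Γ : V → Equiv.Perm ι) :
    2 * energy G h Γ = ∑ x, ∑ y ∈ G.neighborFinset x, permDist (Γ x) (Γ y) +
      2 * ∑ x, permDist (Γ x) (h x) := by
  rw [energy, mul_add, ← smul_eq_mul 2 (∑ e ∈ _, _), ← sum_sum_neighborFinset]
  rfl

/-- The field equal to a permutation on a region and to the identity elsewhere. -/
def regionField (τ : Equiv.Perm ι) (A : Finset V) (x : V) : Equiv.Perm ι := if x ∈ A then τ else 1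

/-- The region where a configuration is far from the identity. -/
def levelSet (Γ : V → Equiv.Perm ι) (k : ℕ) : Finset V := {x | k < permDist 1 (Γ x)}

/-- Coarea inequality: an edge xy is cut by |d(1, Γ x) - d(1, Γ y)| level sets in all, which is at
most d(Γ x, Γ y). -/
theorem sum_surface_levelSet_le (Γ : V → Equiv.Perm ι) (L : ℕ) :
    2 * ∑ k ∈ Finset.range L, surface G (levelSet Γ k) ≤
      ∑ x, ∑ y ∈ G.neighborFinset x, permDist (Γ x) (Γ y) := by
  simp only [Finset.mul_sum, two_mul_surface]
  rw [Finset.sum_comm]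
  refine Finset.sum_le_sum fun x _ => ?_
  rw [Finset.sum_comm]
  refine Finset.sum_le_sum fun y _ => ?_
  have h1 := permDist_triangle 1 (Γ x) (Γ y)
  have h2 := permDist_triangle 1 (Γ y) (Γ x)
  rw [permDist_comm (Γ y)] at h2
  calc _ = ∑ k ∈ Finset.range L,
        if (¬(k < permDist 1 (Γ x) ↔ k < permDist 1 (Γ y))) then 1 else 0 := by
        refine Finset.sum_congr rfl fun k _ => ?_
        simp only [levelSet, Finset.mem_filter_univ, ite_not]
    _ = (Finset.filter (fun k => ¬(k < permDist 1 (Γ x) ↔ k < permDist 1 (Γ y)))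
          (Finset.range L)).card := by rw [Finset.sum_boole, Nat.cast_id]
    _ ≤ (Finset.Ico (min (permDist 1 (Γ x)) (permDist 1 (Γ y)))
          (max (permDist 1 (Γ x)) (permDist 1 (Γ y)))).card := by
        refine Finset.card_le_card fun k hk => ?_
        rw [Finset.mem_filter] at hk
        rw [Finset.mem_Ico]
        omega
    _ ≤ _ := by
        rw [Nat.card_Ico]
        omega

/-- Vertex by vertex: x in A is missed by the levels from d(1, Γ x) up to d(1, τ), at most d(Γ x, τ)
of them. A vertex outside A lies in at most d(1, Γ x) level sets. -/
theorem sum_symmDiff_levelSet_le (Γ : V → Equiv.Perm ι) (τ : Equiv.Perm ι) (A : Finset V) :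
    ∑ k ∈ Finset.range (permDist 1 τ), (symmDiff A (levelSet Γ k)).card ≤
      ∑ x, permDist (Γ x) (regionField τ A x) := by
  have : ∀ k, (symmDiff A (levelSet Γ k)).card =
      ∑ x, if (x ∈ A ↔ k < permDist 1 (Γ x)) then 0 else 1 := by
    intro k
    rw [← Nat.cast_id (Finset.card _), ← Finset.filter_univ_mem (symmDiff A (levelSet Γ k)),
      ← Finset.sum_boole]
    refine Finset.sum_congr rfl fun x _ => ?_
    by_cases h1 : x ∈ A <;> by_cases h2 : k < permDist 1 (Γ x) <;>
      simp [Finset.mem_symmDiff, levelSet, h1, h2]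
  simp only [this]
  rw [Finset.sum_comm]
  refine Finset.sum_le_sum fun x _ => ?_
  by_cases hx : x ∈ A
  · have h1 := permDist_triangle 1 (Γ x) τ
    simp only [regionField, hx, if_true, true_iff]
    calc _ = (Finset.filter (fun k => ¬(k < permDist 1 (Γ x)))
          (Finset.range (permDist 1 τ))).card := by
          rw [← Nat.cast_id (Finset.card _), ← Finset.sum_boole]
          simp only [ite_not]
      _ ≤ (Finset.Ico (permDist 1 (Γ x)) (permDist 1 τ)).card := by
          refine Finset.card_le_card fun k hk => ?_
          rw [Finset.mem_filter, Finset.mem_range] at hk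
          rw [Finset.mem_Ico]
          omega
      _ ≤ _ := by
          rw [Nat.card_Ico]
          omega
  · simp only [regionField, hx, if_false, false_iff]
    calc _ = (Finset.filter (fun k => k < permDist 1 (Γ x))
          (Finset.range (permDist 1 τ))).card := by
          rw [← Nat.cast_id (Finset.card _), ← Finset.sum_boole]
          simp only [ite_not]
      _ ≤ (Finset.range (permDist 1 (Γ x))).card := by
          refine Finset.card_le_card fun k hk => ?_
          rw [Finset.mem_filter] at hk
          rw [Finset.mem_range]
          omega
      _ ≤ _ := by
          rw [Finset.card_range, permDist_comm]

theorem two_mul_energy_regionField (τ : Equiv.Perm ι) (A : Finset V) :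
    2 * energy G (regionField τ A) (regionField τ A) = 2 * (permDist 1 τ * surface G A) := by
  rw [two_mul_energy, mul_left_comm, two_mul_surface]
  simp only [permDist_self, Finset.sum_const_zero, mul_zero, add_zero, Finset.mul_sum]
  refine Finset.sum_congr rfl fun x _ => Finset.sum_congr rfl fun y _ => ?_
  by_cases hx : x ∈ A <;> by_cases hy : y ∈ A <;>
    simp [regionField, hx, hy, permDist_self, permDist_comm τ]

/-- Ferromagnetic stability: misaligned permutations cost energy. -/
theorem energy_gap {θ : ℝ} (hθ : 0 ≤ θ) {A : Finset V} (hA : SmallSurface G θ A)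
    (τ : Equiv.Perm ι) (Γ : V → Equiv.Perm ι) :
    (1 - θ) * ∑ x, (permDist (Γ x) (regionField τ A x) : ℝ) ≤
      (energy G (regionField τ A) Γ : ℝ) - energy G (regionField τ A) (regionField τ A) := by
  have h1 := sum_surface_levelSet_le G Γ (permDist 1 τ)
  have h2 := sum_symmDiff_levelSet_le Γ τ A
  have h3 := two_mul_energy_regionField G τ A
  have h4 := two_mul_energy G (regionField τ A) Γ
  -- The surface condition is tested on each of the d(1, τ) level sets; the ground state energy is
  -- d(1, τ) times the surface of A.
  have h5 : ∑ k ∈ Finset.range (permDist 1 τ), ((surface G A : ℝ) - surface G (levelSet Γ k)) ≤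
      ∑ k ∈ Finset.range (permDist 1 τ), θ * ((symmDiff A (levelSet Γ k)).card : ℝ) :=
    Finset.sum_le_sum fun k _ => hA _
  rw [Finset.sum_sub_distrib, Finset.sum_const, Finset.card_range, nsmul_eq_mul,
    ← Finset.mul_sum] at h5
  have h2' : (∑ k ∈ Finset.range (permDist 1 τ), ((symmDiff A (levelSet Γ k)).card : ℝ)) ≤
      ∑ x, (permDist (Γ x) (regionField τ A x) : ℝ) := by exact_mod_cast h2
  have h1' : 2 * ∑ k ∈ Finset.range (permDist 1 τ), (surface G (levelSet Γ k) : ℝ) ≤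
      ∑ x, ∑ y ∈ G.neighborFinset x, (permDist (Γ x) (Γ y) : ℝ) := by exact_mod_cast h1
  have h3' : 2 * (energy G (regionField τ A) (regionField τ A) : ℝ) =
      2 * (permDist 1 τ * surface G A) := by exact_mod_cast h3
  have h4' : 2 * (energy G (regionField τ A) Γ : ℝ) =
      ∑ x, ∑ y ∈ G.neighborFinset x, (permDist (Γ x) (Γ y) : ℝ) +
        2 * ∑ x, (permDist (Γ x) (regionField τ A x) : ℝ) := by exact_mod_cast h4
  have h6 := mul_le_mul_of_nonneg_left h2' hθ
  linarith

/-! ### Factorization of weights over components of the misaligned set. -/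

/-- The configuration aligned with the field outside a region. -/
def restrictTo (h Γ : V → Equiv.Perm ι) (C : Finset V) (x : V) : Equiv.Perm ι :=
  if x ∈ C then Γ x else h x

open Classical in
/-- The set of misaligned vertices. -/
def misaligned (h Γ : V → Equiv.Perm ι) : Finset V := {x | Γ x ≠ h x}

/-- Energies of configurations misaligned on two regions without edges between them add up. -/
theorem energy_add_energy (h Γ : V → Equiv.Perm ι) (C C' : Finset V) (hd : Disjoint C C')
    (hadj : ∀ x ∈ C, ∀ y ∈ C', ¬G.Adj x y) (hΓ : ∀ x, x ∉ C → x ∉ C' → Γ x = h x) :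
    energy G h Γ + energy G h h = energy G h (restrictTo h Γ C) + energy G h (restrictTo h Γ C') := by
  have hd' : ∀ x ∈ C, x ∉ C' := fun x hx hx' => Finset.disjoint_left.1 hd hx hx'
  have hx : ∀ x, permDist (Γ x) (h x) = permDist (restrictTo h Γ C x) (h x) +
      permDist (restrictTo h Γ C' x) (h x) := by
    intro x
    by_cases h1 : x ∈ C
    · simp [restrictTo, h1, hd' x h1, permDist_self]
    · by_cases h2 : x ∈ C'
      · simp [restrictTo, h1, h2, permDist_self]
      · simp [restrictTo, h1, h2, permDist_self, hΓ x h1 h2]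
  have he : ∀ e ∈ G.edgeFinset, edgeDist Γ e + edgeDist h e =
      edgeDist (restrictTo h Γ C) e + edgeDist (restrictTo h Γ C') e := by
    intro e he
    induction e using Sym2.ind with
    | _ x y =>
      rw [SimpleGraph.mem_edgeFinset, SimpleGraph.mem_edgeSet] at he
      have a1 := hd' x
      have a2 := hd' y
      have a3 := hadj x
      have a4 := hadj y
      have b1 := hΓ x
      have b2 := hΓ y
      have he' := he.symm
      simp only [edgeDist_mk, restrictTo]
      by_cases h1 : x ∈ C <;> by_cases h2 : x ∈ C' <;> by_cases h3 : y ∈ C <;>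
        by_cases h4 : y ∈ C' <;> simp_all [add_comm]
  rw [energy_self]
  unfold energy
  rw [Finset.sum_congr rfl fun x _ => hx x, Finset.sum_add_distrib]
  have := Finset.sum_congr rfl he
  rw [Finset.sum_add_distrib, Finset.sum_add_distrib] at this
  omega

@[simp]
theorem mem_misaligned {h Γ : V → Equiv.Perm ι} {x : V} : x ∈ misaligned h Γ ↔ Γ x ≠ h x := by
  simp [misaligned]

theorem misaligned_restrictTo {h Γ : V → Equiv.Perm ι} {C : Finset V}
    (hC : C ⊆ misaligned h Γ) : misaligned h (restrictTo h Γ C) = C := by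
  ext x
  by_cases hx : x ∈ C
  · simpa [restrictTo, hx] using hC hx
  · simp [restrictTo, hx]

/-- The energy of a configuration above the energy of the field. -/
def excess (h Γ : V → Equiv.Perm ι) : ℤ := (energy G h Γ : ℤ) - energy G h h

/-- If every misaligned configuration has small weight, the weight factors over components. -/
theorem weight_le_of_components (h : V → Equiv.Perm ι) {D a t : ℝ} (hD : 0 < D) (ha : 0 ≤ a)
    (ha1 : a ≤ 1) (ht : 0 ≤ t)
    (hw : ∀ Γ : V → Equiv.Perm ι, (misaligned h Γ).Nonempty →
      D ^ (-excess G h Γ) ≤ a * t ^ (misaligned h Γ).card)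
    (Γ : V → Equiv.Perm ι) :
    D ^ (-excess G h Γ) ≤
      t ^ (misaligned h Γ).card * a ^ (componentsAvoiding G (misaligned h Γ) ∅).card := by
  induction hn : (misaligned h Γ).card using Nat.strong_induction_on generalizing Γ with
  | _ n ih =>
    subst hn
    rcases (misaligned h Γ).eq_empty_or_nonempty with h0 | ⟨x, hx⟩
    · have hΓ : Γ = h := by
        funext x
        by_contra hne
        exact Finset.notMem_empty x (h0 ▸ mem_misaligned.2 hne)
      rw [h0, componentsAvoiding_empty, hΓ]
      simp [excess]
    · obtain ⟨C, hC, hxC⟩ := exists_isComponent_mem (G := G) hx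
      have hCM := hC.subset
      have hM'M : misaligned h Γ \ C ⊆ misaligned h Γ := Finset.sdiff_subset
      have hadd := energy_add_energy G h Γ C (misaligned h Γ \ C) Finset.disjoint_sdiff
        (fun x hx y hy => hC.1.2 x hx y (hM'M hy) (Finset.mem_sdiff.1 hy).2)
        (fun x hx hx' => by
          by_contra hne
          exact hx' (Finset.mem_sdiff.2 ⟨mem_misaligned.2 hne, hx⟩))
      have hex : -excess G h Γ = -excess G h (restrictTo h Γ C) +
          -excess G h (restrictTo h Γ (misaligned h Γ \ C)) := by
        unfold excess
        omega
      have hcard : (misaligned h Γ \ C).card + C.card = (misaligned h Γ).card :=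
        Finset.card_sdiff_add_card_eq_card hCM
      have hCpos : 0 < C.card := hC.2.1.card_pos
      have h1 := hw (restrictTo h Γ C) (by rw [misaligned_restrictTo hCM]; exact hC.2.1)
      have h2 := ih (misaligned h Γ \ C).card (by omega) (restrictTo h Γ (misaligned h Γ \ C))
        (by rw [misaligned_restrictTo hM'M])
      rw [misaligned_restrictTo hCM] at h1
      rw [misaligned_restrictTo hM'M] at h2
      -- Removing C destroys no other component. One inclusion suffices, since a ≤ 1 makes an upper
      -- bound on the number of components enough.
      have hcomp : componentsAvoiding G (misaligned h Γ) ∅ ⊆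
          insert C (componentsAvoiding G (misaligned h Γ \ C) ∅) := by
        intro P hP
        rw [mem_componentsAvoiding] at hP
        rw [Finset.mem_insert, mem_componentsAvoiding]
        rcases (C ∩ P).eq_empty_or_nonempty with hCP | hCP
        · right
          have hPM' : P ⊆ misaligned h Γ \ C := fun z hz =>
            Finset.mem_sdiff.2 ⟨hP.1.subset hz, fun hzC =>
              Finset.notMem_empty z (hCP ▸ Finset.mem_inter.2 ⟨hzC, hz⟩)⟩
          refine ⟨⟨⟨hPM', fun u hu v hv hvP => hP.1.1.2 u hu v (hM'M hv) hvP⟩, hP.1.2.1,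
            fun R hRP hRne hR => hP.1.2.2 R hRP hRne ⟨hRP.trans hP.1.subset,
              fun u hu v hv hvR => ?_⟩⟩, hP.2⟩
          by_cases hvC : v ∈ C
          · exact fun hadj => hC.1.2 v hvC u (hP.1.subset (hRP hu))
              (Finset.mem_sdiff.1 (hPM' (hRP hu))).2 hadj.symm
          · exact hR.2 u hu v (Finset.mem_sdiff.2 ⟨hv, hvC⟩) hvR
        · left
          have hs := hC.1.inter hP.1.1
          exact (hP.1.2.2 _ Finset.inter_subset_right hCP hs).symm.trans
            (hC.2.2 _ Finset.inter_subset_left hCP hs)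
      have hc := (Finset.card_le_card hcomp).trans (Finset.card_insert_le _ _)
      rw [hex, zpow_add₀ hD.ne']
      calc _ ≤ (a * t ^ C.card) * (t ^ (misaligned h Γ \ C).card *
            a ^ (componentsAvoiding G (misaligned h Γ \ C) ∅).card) := by
            gcongr
        _ = t ^ (misaligned h Γ).card *
            a ^ ((componentsAvoiding G (misaligned h Γ \ C) ∅).card + 1) := by
            rw [← hcard]
            ring
        _ ≤ _ := by
            gcongr ?_ * ?_
            exact pow_le_pow_of_le_one ha ha1 hc

/-! ### The low temperature expansion. -/

/-- One of the e factors 1/D is kept and the remaining e - 1 are weakened to 1/D₀. The kept factor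
is what makes the final error linear in 1/D, whatever κ is. -/
theorem rpow_excess_bound {D D₀ κ : ℝ} (hD₀ : 1 ≤ D₀) (hD : D₀ ≤ D) {e : ℤ} {k : ℕ}
    (he : 1 ≤ e) (hk : κ * k ≤ e) : D ^ (-e) ≤ D₀ / D * (D₀ ^ (-κ)) ^ k := by
  have h0 : 0 < D₀ := by linarith
  have h1 : 0 < D := by linarith
  have h2 : D ^ (-e) = D ^ (-(e - 1)) / D := by
    rw [eq_div_iff h1.ne', ← zpow_add_one₀ h1.ne']
    congr 1
    ring
  have h3 : D ^ (-(e - 1)) ≤ D₀ ^ (-(e - 1)) := by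
    rw [zpow_neg, zpow_neg]
    exact inv_anti₀ (zpow_pos h0 _) (zpow_le_zpow_left₀ (by omega) h0.le hD)
  have h4 : D₀ ^ (-(e - 1)) = D₀ * D₀ ^ (-e) := by
    rw [← zpow_one_add₀ h0.ne']
    congr 1
    ring
  have h5 : D₀ ^ (-e) ≤ (D₀ ^ (-κ)) ^ k := by
    rw [← Real.rpow_intCast, ← Real.rpow_natCast, ← Real.rpow_mul h0.le]
    refine Real.rpow_le_rpow_of_exponent_le hD₀ ?_
    push_cast
    linarith
  rw [h2, div_mul_eq_mul_div]
  gcongr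
  rw [h4] at h3
  exact h3.trans (by gcongr)

/-- The bond dimension above which the low temperature expansion converges. -/
def criticalDim (ι : Type*) (Δ : ℕ) (κ : ℝ) : ℝ :=
  ((Nat.card (Equiv.Perm ι) : ℝ) * 2 ^ Δ) ^ (1 / κ)

theorem one_le_criticalDim (Δ : ℕ) {κ : ℝ} (hκ : 0 < κ) : 1 ≤ criticalDim ι Δ κ := by
  refine Real.one_le_rpow ?_ (by positivity)
  have h1 : (1 : ℝ) ≤ Nat.card (Equiv.Perm ι) := by exact_mod_cast Nat.card_pos
  have h2 : (1 : ℝ) ≤ 2 ^ Δ := one_le_pow₀ (by norm_num)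
  nlinarith

theorem card_misaligned_eq_le [Fintype ι] [DecidableEq ι] (h : V → Equiv.Perm ι) (M : Finset V) :
    (Finset.univ.filter fun Γ => misaligned h Γ = M).card ≤
      Nat.card (Equiv.Perm ι) ^ M.card := by
  have hsub : (Finset.univ.filter fun Γ => misaligned h Γ = M) ⊆
      Fintype.piFinset fun x => if x ∈ M then Finset.univ else {h x} := by
    intro Γ hΓ
    rw [Finset.mem_filter_univ] at hΓ
    rw [Fintype.mem_piFinset]
    intro x
    by_cases hx : x ∈ M
    · simp [hx]
    · rw [← hΓ, mem_misaligned, not_not] at hx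
      rw [← hΓ]
      simp [hx]
  refine (Finset.card_le_card hsub).trans_eq ?_
  rw [Fintype.card_piFinset, Nat.card_eq_fintype_card]
  simp only [apply_ite Finset.card, Finset.card_univ, Finset.card_singleton]
  rw [Finset.prod_ite_mem, Finset.univ_inter, Finset.prod_const]

/-- The low temperature bound: the relative weight of all configurations. -/
theorem sum_excess_weight_le [Fintype ι] [DecidableEq ι] {Δ : ℕ} (hΔ : ∀ x, G.degree x ≤ Δ)
    (h : V → Equiv.Perm ι) {κ : ℝ} (hκ : 0 < κ)
    (hgap : ∀ Γ : V → Equiv.Perm ι, κ * ∑ x, (permDist (Γ x) (h x) : ℝ) ≤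
      (energy G h Γ : ℝ) - energy G h h)
    {D : ℝ} (hD : criticalDim ι Δ κ ≤ D) :
    ∑ Γ : V → Equiv.Perm ι, D ^ (-excess G h Γ) ≤
      Real.exp (criticalDim ι Δ κ * Fintype.card V / D) := by
  set D₀ := criticalDim ι Δ κ with hD₀
  have h1 : 1 ≤ D₀ := one_le_criticalDim Δ hκ
  have h0 : 0 < D₀ := by linarith
  have hDp : 0 < D := by linarith
  have ha : 0 ≤ D₀ / D := by positivity
  have ha1 : D₀ / D ≤ 1 := (div_le_one hDp).2 hD
  have hq : (0 : ℝ) < Nat.card (Equiv.Perm ι) := by exact_mod_cast Nat.card_pos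
  -- This equation dictates `criticalDim`: after the choice of permutation is counted, each
  -- misaligned vertex carries exactly the weight 2^(-Δ) of `exploration_bound`.
  have hqt : (Nat.card (Equiv.Perm ι) : ℝ) * D₀ ^ (-κ) = 2⁻¹ ^ Δ := by
    rw [hD₀, criticalDim, ← Real.rpow_mul (by positivity)]
    have : 1 / κ * -κ = -1 := by field_simp
    rw [this, Real.rpow_neg_one, mul_inv, mul_inv_cancel_left₀ hq.ne', inv_pow]
  have hw : ∀ Γ : V → Equiv.Perm ι, (misaligned h Γ).Nonempty →
      D ^ (-excess G h Γ) ≤ D₀ / D * (D₀ ^ (-κ)) ^ (misaligned h Γ).card := by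
    intro Γ hne
    have hsum : ((misaligned h Γ).card : ℝ) ≤ ∑ x, (permDist (Γ x) (h x) : ℝ) := by
      have : (misaligned h Γ).card ≤ ∑ x, permDist (Γ x) (h x) := by
        rw [Finset.card_eq_sum_ones]
        exact (Finset.sum_le_sum fun x hx => permDist_pos (mem_misaligned.1 hx)).trans
          (Finset.sum_le_sum_of_subset (Finset.subset_univ _))
      exact_mod_cast this
    have hg := hgap Γ
    have hex : ((excess G h Γ : ℤ) : ℝ) = (energy G h Γ : ℝ) - energy G h h := by
      simp [excess]
    have hk : κ * (misaligned h Γ).card ≤ (excess G h Γ : ℤ) := by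
      rw [hex]
      exact (mul_le_mul_of_nonneg_left hsum hκ.le).trans hg
    have hpos : (0 : ℝ) < (excess G h Γ : ℤ) :=
      lt_of_lt_of_le (mul_pos hκ (by exact_mod_cast hne.card_pos)) hk
    exact rpow_excess_bound h1 hD (by exact_mod_cast hpos) hk
  have key := weight_le_of_components G h hDp ha ha1 (Real.rpow_nonneg h0.le (-κ)) hw
  calc ∑ Γ : V → Equiv.Perm ι, D ^ (-excess G h Γ)
      ≤ ∑ Γ : V → Equiv.Perm ι, (D₀ ^ (-κ)) ^ (misaligned h Γ).card *
          (D₀ / D) ^ (componentsAvoiding G (misaligned h Γ) ∅).card :=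
        Finset.sum_le_sum fun Γ _ => key Γ
    _ = ∑ M : Finset V, ∑ Γ ∈ Finset.univ.filter (fun Γ => misaligned h Γ = M),
          (D₀ ^ (-κ)) ^ (misaligned h Γ).card *
          (D₀ / D) ^ (componentsAvoiding G (misaligned h Γ) ∅).card :=
        (Finset.sum_fiberwise _ _ _).symm
    _ ≤ ∑ M : Finset V, ((2 : ℝ)⁻¹ ^ Δ) ^ M.card *
          (D₀ / D) ^ (componentsAvoiding G M ∅).card := by
        refine Finset.sum_le_sum fun M _ => ?_
        rw [Finset.sum_congr rfl fun Γ hΓ => by rw [(Finset.mem_filter.1 hΓ).2], Finset.sum_const,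
          nsmul_eq_mul, ← hqt, mul_pow, mul_assoc]
        gcongr
        exact_mod_cast card_misaligned_eq_le h M
    _ ≤ (1 + D₀ / D) ^ (Finset.univ : Finset V).card * 2 ^ (∅ : Finset V).card := by
        rw [← Finset.powerset_univ]
        exact exploration_bound hΔ ha ha1 _ _ (Finset.empty_subset _)
    _ ≤ _ := by
        rw [Finset.card_empty, pow_zero, mul_one, Finset.card_univ]
        calc (1 + D₀ / D) ^ Fintype.card V ≤ Real.exp (D₀ / D) ^ Fintype.card V := by
              gcongr
              rw [add_comm]
              exact Real.add_one_le_exp _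
          _ = _ := by
              rw [← Real.exp_nat_mul]
              congr 1
              ring

end Energy

/-! ### Replicated averages of the random network -/

section Replicas

variable {V : Type*} [Fintype V] [DecidableEq V] (G : SimpleGraph V) [DecidableRel G.Adj] (D : ℕ)
variable {R : Type*} [Fintype R] [DecidableEq R]

/-- The labels of the virtual legs at a vertex. -/
def legs (e : G.edgeSet → Fin D) (x : V) (y : G.neighborSet x) : Fin D := e ⟨s(x, y), y.2⟩

/-- The statistical weight of a configuration in a field. -/
def weight (h Γ : V → Equiv.Perm R) : ℝ :=
  (∏ x, (D : ℝ) ^ Fintype.card R / ((D ^ (G.degree x + 1)).ascFactorial (Fintype.card R) : ℝ)) *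
    (D : ℝ) ^ (-(energy G h Γ : ℤ))

theorem card_vertexIndex (x : V) :
    Fintype.card (VertexIndex G D x) = D ^ (G.degree x + 1) := by
  rw [Fintype.card_prod, Fintype.card_fun, Fintype.card_fin, G.card_neighborSet_eq_degree,
    pow_succ]

theorem card_physical (h Γ : V → Equiv.Perm R) :
    Nat.card {p : R → V → Fin D // ∀ x i, p (Γ x i) x = p (h x i) x} =
      ∏ x, D ^ orbitCount ((Γ x)⁻¹ * h x) := by
  refine (Nat.card_congr (((Equiv.piComm fun (_ : R) (_ : V) => Fin D).subtypeEquiv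
    (q := fun q => ∀ x, ∀ i, q x (Γ x i) = q x (h x i)) fun p => Iff.rfl).trans
    (Equiv.subtypePiEquivPi (p := fun x (f : R → Fin D) => ∀ i, f (Γ x i) = f (h x i))))).trans ?_
  rw [Nat.card_pi]
  refine Finset.prod_congr rfl fun x _ => ?_
  rw [card_coincident, Nat.card_fin]

/-- The constraint at one end determines the second colouring from the first. The other end then
asks the first to coincide along the two permutations. -/
theorem card_edge_pairs (Γ : V → Equiv.Perm R) (e : Sym2 V) :
    Nat.card {q : (R → Fin D) × (R → Fin D) // ∀ x ∈ e, ∀ i, q.1 (Γ x i) = q.2 i} =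
      D ^ (Fintype.card R - edgeDist Γ e) := by
  induction e using Sym2.ind with
  | _ x y =>
    have h := permDist_add_orbitCount (Γ x) (Γ y)
    rw [Nat.card_eq_fintype_card] at h
    rw [edgeDist_mk, ← h, Nat.add_sub_cancel_left]
    have hc := card_coincident (Γ x) (Γ y) (Fin D)
    rw [Nat.card_fin] at hc
    rw [← hc]
    refine Nat.card_congr
      { toFun := fun q => ⟨q.1.1, fun i => (q.2 x (Sym2.mem_mk_left x y) i).trans
          (q.2 y (Sym2.mem_mk_right x y) i).symm⟩
        invFun := fun f => ⟨(f.1, fun i => f.1 (Γ x i)), fun z hz i => ?_⟩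
        left_inv := fun q => ?_
        right_inv := fun f => rfl }
    · rcases Sym2.mem_iff.1 hz with rfl | rfl
      · rfl
      · exact (f.2 i).symm
    · exact Subtype.ext (Prod.ext rfl (funext fun i => q.2 x (Sym2.mem_mk_left x y) i))

/-- Each bond label is shared by both ends of its edge, so the vertex constraints regroup into
independent constraints per edge. -/
theorem card_virtual (Γ : V → Equiv.Perm R) :
    Nat.card {q : (R → G.edgeSet → Fin D) × (R → G.edgeSet → Fin D) //
      ∀ x i, legs G D (q.1 (Γ x i)) x = legs G D (q.2 i) x} =
      ∏ e ∈ G.edgeFinset, D ^ (Fintype.card R - edgeDist Γ e) := by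
  let e₁ : ((R → G.edgeSet → Fin D) × (R → G.edgeSet → Fin D)) ≃
      (G.edgeSet → (R → Fin D) × (R → Fin D)) :=
    ((Equiv.piComm _).prodCongr (Equiv.piComm _)).trans (Equiv.arrowProdEquivProdArrow _ _ _).symm
  have h1 : ∀ q : (R → G.edgeSet → Fin D) × (R → G.edgeSet → Fin D),
      (∀ x i, legs G D (q.1 (Γ x i)) x = legs G D (q.2 i) x) ↔
      ∀ ε : G.edgeSet, ∀ x ∈ (ε : Sym2 V), ∀ i, (e₁ q ε).1 (Γ x i) = (e₁ q ε).2 i := by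
    intro q
    constructor
    · rintro h ⟨ε, hε⟩ x hx i
      obtain ⟨y, rfl⟩ := Sym2.mem_iff_exists.1 hx
      exact congrFun (h x i) ⟨y, hε⟩
    · intro h x i
      funext y
      exact h ⟨s(x, y), y.2⟩ x (Sym2.mem_mk_left x y) i
  rw [Nat.card_congr ((e₁.subtypeEquiv h1).trans (Equiv.subtypePiEquivPi
    (p := fun (ε : G.edgeSet) (q : (R → Fin D) × (R → Fin D)) =>
      ∀ x ∈ (ε : Sym2 V), ∀ i, q.1 (Γ x i) = q.2 i))), Nat.card_pi]
  simp only [card_edge_pairs]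
  exact (Finset.prod_subtype G.edgeFinset (fun _ => SimpleGraph.mem_edgeFinset)
    fun e => D ^ (Fintype.card R - edgeDist Γ e)).symm

variable [NeZero D]

/-- The replicated network, contracted along a field of permutations. -/
def replicaSum (h : V → Equiv.Perm R) (U : Sample G D) : ℂ :=
  ∑ p : R → V → Fin D, (∏ i, pepsState G D U (p i)) *
    ∏ i, star (pepsState G D U fun x => p (h x i) x)

theorem replicaSum_eq (h : V → Equiv.Perm R) (U : Sample G D) :
    replicaSum G D h U = ((D : ℂ)⁻¹ ^ G.edgeFinset.card) ^ Fintype.card R *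
      ∑ p : R → V → Fin D, ∑ e : R → G.edgeSet → Fin D, ∑ e' : R → G.edgeSet → Fin D,
        ∏ x, ((∏ i, column (fun _ => 0, 0) (U x) (legs G D (e i) x, p i x)) *
          ∏ i, star (column (fun _ => 0, 0) (U x) (legs G D (e' i) x, p (h x i) x))) := by
  have hc : ((((Real.sqrt D)⁻¹ ^ G.edgeFinset.card : ℝ) : ℂ)) *
      ((((Real.sqrt D)⁻¹ ^ G.edgeFinset.card : ℝ) : ℂ)) = (D : ℂ)⁻¹ ^ G.edgeFinset.card := by
    rw [← Complex.ofReal_mul, ← mul_pow, ← mul_inv, Real.mul_self_sqrt (Nat.cast_nonneg D)]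
    simp
  have h1 : ∀ p : V → Fin D, pepsState G D U p =
      (((Real.sqrt D)⁻¹ ^ G.edgeFinset.card : ℝ) : ℂ) * ∑ e : G.edgeSet → Fin D,
        ∏ x, column (fun _ => 0, 0) (U x) (legs G D e x, p x) := fun p => rfl
  rw [replicaSum, ← hc, mul_pow, Finset.mul_sum]
  refine Finset.sum_congr rfl fun p _ => ?_
  simp only [h1, star_mul', Finset.prod_mul_distrib, Finset.prod_const, Finset.card_univ,
    star_sum, star_prod]
  rw [Fintype.prod_sum, Fintype.prod_sum, Complex.star_def, Complex.conj_ofReal,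
    mul_mul_mul_comm, Finset.sum_mul_sum]
  congr 1
  refine Finset.sum_congr rfl fun e _ => Finset.sum_congr rfl fun e' _ => ?_
  rw [Finset.prod_comm, Finset.prod_comm (s := Finset.univ (α := R))]

theorem integrable_vertex_prod (α β : ∀ x, R → VertexIndex G D x) :
    Integrable (fun U : Sample G D => ∏ x, ((∏ i, column (fun _ => 0, 0) (U x) (α x i)) *
      ∏ i, star (column (fun _ => 0, 0) (U x) (β x i)))) (sampleMeasure G D) :=
  Integrable.fintype_prod_dep fun x => integrable_haarUnitary (continuous_monomial _ (α x) (β x))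

theorem integrable_replicaSum (h : V → Equiv.Perm R) :
    Integrable (replicaSum G D h) (sampleMeasure G D) := by
  have : replicaSum G D h = _ := funext (replicaSum_eq G D h)
  rw [this]
  refine Integrable.const_mul (integrable_finsetSum _ fun p _ => integrable_finsetSum _ fun e _ =>
    integrable_finsetSum _ fun e' _ => ?_) _
  exact integrable_vertex_prod G D (fun x i => (legs G D (e i) x, p i x))
    (fun x i => (legs G D (e' i) x, p (h x i) x))

theorem integral_vertex_prod (α β : ∀ x, R → VertexIndex G D x) :
    ∫ U : Sample G D, ∏ x, ((∏ i, column (fun _ => 0, 0) (U x) (α x i)) *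
      ∏ i, star (column (fun _ => 0, 0) (U x) (β x i))) ∂sampleMeasure G D =
    (∏ x, (((D ^ (G.degree x + 1)).ascFactorial (Fintype.card R) : ℕ) : ℂ)⁻¹) *
      ∑ Γ : V → Equiv.Perm R, if ∀ x i, α x (Γ x i) = β x i then 1 else 0 := by
  rw [sampleMeasure, integral_fintype_prod_eq_prod
    (f := fun x (W : Matrix.unitaryGroup (VertexIndex G D x) ℂ) =>
      (∏ i, column (fun _ => 0, 0) W (α x i)) * ∏ i, star (column (fun _ => 0, 0) W (β x i)))]
  have h1 : ∀ x, ∫ W, (∏ i, column (fun _ => 0, 0) W (α x i)) *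
      ∏ i, star (column (fun _ => 0, 0) W (β x i)) ∂haarUnitary (VertexIndex G D x) =
      (((D ^ (G.degree x + 1)).ascFactorial (Fintype.card R) : ℕ) : ℂ)⁻¹ *
        ∑ π : Equiv.Perm R, if ∀ i, α x (π i) = β x i then 1 else 0 := fun x => by
    rw [← card_vertexIndex]
    exact haarMoment_eq _ (α x) (β x)
  simp only [h1]
  rw [Finset.prod_mul_distrib, Fintype.prod_sum]
  simp only [Fintype.prod_boole]

theorem sum_indicator_eq (h Γ : V → Equiv.Perm R) :
    (∑ p : R → V → Fin D, ∑ e : R → G.edgeSet → Fin D, ∑ e' : R → G.edgeSet → Fin D,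
      if ∀ x i, ((legs G D (e (Γ x i)) x, p (Γ x i) x) : VertexIndex G D x) =
        (legs G D (e' i) x, p (h x i) x) then (1 : ℂ) else 0) =
      ((∏ x, D ^ orbitCount ((Γ x)⁻¹ * h x)) *
        ∏ e ∈ G.edgeFinset, D ^ (Fintype.card R - edgeDist Γ e) : ℕ) := by
  classical
  rw [← card_physical, ← card_virtual, Nat.card_eq_fintype_card, Nat.card_eq_fintype_card,
    Fintype.card_subtype, Fintype.card_subtype, Nat.cast_mul, ← Finset.sum_boole,
    ← Finset.sum_boole, Finset.sum_mul_sum]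
  refine Finset.sum_congr rfl fun p _ => ?_
  rw [Fintype.sum_prod_type]
  refine Finset.sum_congr rfl fun e _ => Finset.sum_congr rfl fun e' _ => ?_
  rw [mul_ite, mul_one, mul_zero, ← ite_and]
  refine if_congr ?_ rfl rfl
  simp only [Prod.mk.injEq, forall_and]

/-- The D^(-1/2) normalizations of the bonds cancel the largest possible count D^(n |E|), with n =
`Fintype.card R`; only the powers of D lost to misalignment remain. -/
theorem weight_eq (h Γ : V → Equiv.Perm R) :
    weight G D h Γ = ((D : ℝ)⁻¹ ^ G.edgeFinset.card) ^ Fintype.card R *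
      ((∏ x, (((D ^ (G.degree x + 1)).ascFactorial (Fintype.card R) : ℕ) : ℝ)⁻¹) *
      ((∏ x, D ^ orbitCount ((Γ x)⁻¹ * h x)) *
        ∏ e ∈ G.edgeFinset, D ^ (Fintype.card R - edgeDist Γ e) : ℕ)) := by
  have hD : (D : ℝ) ≠ 0 := NeZero.ne _
  have hx : ∀ x, (D : ℝ) ^ orbitCount ((Γ x)⁻¹ * h x) =
      (D : ℝ) ^ Fintype.card R * ((D : ℝ) ^ permDist (Γ x) (h x))⁻¹ := fun x => by
    rw [← Nat.card_eq_fintype_card, ← permDist_add_orbitCount (Γ x) (h x), pow_add]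
    field_simp
  have he : ∀ e, (D : ℝ) ^ (Fintype.card R - edgeDist Γ e) =
      (D : ℝ) ^ Fintype.card R * ((D : ℝ) ^ edgeDist Γ e)⁻¹ := fun e => by
    have : edgeDist Γ e ≤ Fintype.card R := by
      induction e using Sym2.ind with
      | _ x y =>
        rw [edgeDist_mk, ← Nat.card_eq_fintype_card, permDist]
        exact Nat.sub_le _ _
    rw [pow_sub₀ _ hD this]
  push_cast
  simp only [hx, he, weight, energy, Finset.prod_mul_distrib, Finset.prod_const, div_eq_mul_inv,
    Finset.prod_inv_distrib, Finset.prod_pow_eq_pow_sum]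
  rw [zpow_neg, zpow_natCast, pow_add, mul_inv]
  have : ((D : ℝ)⁻¹ ^ G.edgeFinset.card) ^ Fintype.card R *
      ((D : ℝ) ^ Fintype.card R) ^ G.edgeFinset.card = 1 := by
    rw [← pow_mul, ← pow_mul, mul_comm (Fintype.card R), ← mul_pow, inv_mul_cancel₀ hD, one_pow]
  generalize ((D : ℝ)⁻¹ ^ G.edgeFinset.card) ^ Fintype.card R = u at this ⊢
  generalize ((D : ℝ) ^ Fintype.card R) ^ G.edgeFinset.card = v at this ⊢
  generalize ((D : ℝ) ^ Fintype.card R) ^ (Finset.univ : Finset V).card = w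
  generalize ((D : ℝ) ^ ∑ e ∈ G.edgeFinset, edgeDist Γ e)⁻¹ = y
  generalize ((D : ℝ) ^ ∑ x, permDist (Γ x) (h x))⁻¹ = z
  generalize (∏ x, ((D ^ (G.degree x + 1)).ascFactorial (Fintype.card R) : ℝ))⁻¹ = b
  linear_combination (-(w * b * y * z)) * this

theorem integral_replicaSum (h : V → Equiv.Perm R) :
    ∫ U, replicaSum G D h U ∂sampleMeasure G D = ((∑ Γ, weight G D h Γ : ℝ) : ℂ) := by
  simp only [replicaSum_eq]
  rw [integral_const_mul, integral_finsetSum _ fun p _ => integrable_finsetSum _ fun e _ =>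
    integrable_finsetSum _ fun e' _ => integrable_vertex_prod G D
      (fun x i => (legs G D (e i) x, p i x)) (fun x i => (legs G D (e' i) x, p (h x i) x))]
  have h1 : ∀ p : R → V → Fin D, ∫ U, ∑ e : R → G.edgeSet → Fin D,
      ∑ e' : R → G.edgeSet → Fin D,
        ∏ x, ((∏ i, column (fun _ => 0, 0) (U x) (legs G D (e i) x, p i x)) *
          ∏ i, star (column (fun _ => 0, 0) (U x) (legs G D (e' i) x, p (h x i) x)))
        ∂sampleMeasure G D = ∑ e : R → G.edgeSet → Fin D, ∑ e' : R → G.edgeSet → Fin D,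
        (∏ x, (((D ^ (G.degree x + 1)).ascFactorial (Fintype.card R) : ℕ) : ℂ)⁻¹) *
      ∑ Γ : V → Equiv.Perm R, if ∀ x i, ((legs G D (e (Γ x i)) x, p (Γ x i) x) :
        VertexIndex G D x) = (legs G D (e' i) x, p (h x i) x) then (1 : ℂ) else 0 := by
    intro p
    rw [integral_finsetSum _ fun e _ =>
      integrable_finsetSum _ fun e' _ => integrable_vertex_prod G D
      (fun x i => (legs G D (e i) x, p i x)) (fun x i => (legs G D (e' i) x, p (h x i) x))]
    refine Finset.sum_congr rfl fun e _ => ?_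
    rw [integral_finsetSum _ fun e' _ => integrable_vertex_prod G D
      (fun x i => (legs G D (e i) x, p i x)) (fun x i => (legs G D (e' i) x, p (h x i) x))]
    refine Finset.sum_congr rfl fun e' _ => ?_
    exact integral_vertex_prod G D
      (fun x i => (legs G D (e i) x, p i x)) (fun x i => (legs G D (e' i) x, p (h x i) x))
  simp only [h1, ← Finset.mul_sum]
  have h2 : (∑ p : R → V → Fin D, ∑ e : R → G.edgeSet → Fin D, ∑ e' : R → G.edgeSet → Fin D,
      ∑ Γ : V → Equiv.Perm R, if ∀ x i, ((legs G D (e (Γ x i)) x, p (Γ x i) x) :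
        VertexIndex G D x) = (legs G D (e' i) x, p (h x i) x) then (1 : ℂ) else 0) =
      ∑ Γ : V → Equiv.Perm R, (((∏ x, D ^ orbitCount ((Γ x)⁻¹ * h x)) *
        ∏ e ∈ G.edgeFinset, D ^ (Fintype.card R - edgeDist Γ e) : ℕ) : ℂ) := by
    simp only [← sum_indicator_eq]
    rw [Finset.sum_comm (s := Finset.univ (α := V → Equiv.Perm R))]
    refine Finset.sum_congr rfl fun p _ => ?_
    rw [Finset.sum_comm (s := Finset.univ (α := V → Equiv.Perm R))]
    refine Finset.sum_congr rfl fun e _ => ?_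
    rw [Finset.sum_comm (s := Finset.univ (α := V → Equiv.Perm R))]
  rw [h2]
  simp only [weight_eq, ← Finset.mul_sum]
  push_cast
  rfl

end Replicas

/-! ### Powers of the reduced density matrix as replicated averages -/

section Traces

/-- The arbitrary endpoint weight g carries the induction; taking g to be the closing matrix entry
turns the open path into a trace. -/
theorem sum_path_prod {κ S : Type*} [Fintype κ] [DecidableEq κ] [CommRing S] (M : Matrix κ κ S)
    (k : ℕ) (g : κ → κ → S) :
    ∑ c : Fin (k + 1) → κ, (∏ i : Fin k, M (c i.castSucc) (c i.succ)) * g (c 0) (c (Fin.last k)) =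
      ∑ a, ∑ b, (M ^ k) a b * g a b := by
  induction k generalizing g with
  | zero =>
    rw [← (Equiv.funUnique (Fin 1) κ).symm.sum_comp]
    simp [Matrix.one_apply]
  | succ k ih =>
    rw [← (Fin.consEquiv fun _ => κ).sum_comp, Fintype.sum_prod_type]
    refine Finset.sum_congr rfl fun a _ => ?_
    have h := ih fun x y => M a x * g a y
    have h1 : ∀ c : Fin (k + 1) → κ, (∏ i : Fin (k + 1),
        M ((Fin.consEquiv fun _ => κ) (a, c) i.castSucc) ((Fin.consEquiv fun _ => κ) (a, c) i.succ)) *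
        g ((Fin.consEquiv fun _ => κ) (a, c) 0) ((Fin.consEquiv fun _ => κ) (a, c) (Fin.last _)) =
        (∏ i : Fin k, M (c i.castSucc) (c i.succ)) * (M a (c 0) * g a (c (Fin.last k))) := by
      intro c
      rw [Fin.prod_univ_succ]
      simp only [Fin.consEquiv_apply, Fin.castSucc_zero, Fin.cons_zero, Fin.cons_succ,
        ← Fin.succ_castSucc, ← Fin.succ_last]
      ring
    rw [Finset.sum_congr rfl fun c _ => h1 c, h, Finset.sum_comm]
    refine Finset.sum_congr rfl fun b _ => ?_
    rw [pow_succ', Matrix.mul_apply, Finset.sum_mul]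
    refine Finset.sum_congr rfl fun x _ => ?_
    ring

theorem trace_pow_eq_sum_finRotate {κ S : Type*} [Fintype κ] [DecidableEq κ] [CommRing S]
    (M : Matrix κ κ S) {n : ℕ} (hn : n ≠ 0) :
    (M ^ n).trace = ∑ a : Fin n → κ, ∏ i, M (a i) (a (finRotate n i)) := by
  obtain ⟨k, rfl⟩ := Nat.exists_eq_succ_of_ne_zero hn
  have h := sum_path_prod M k fun a b => M b a
  simp only [Fin.prod_univ_castSucc (n := k), finRotate_apply, Fin.coeSucc_eq_succ,
    Fin.last_add_one]
  rw [h, Nat.succ_eq_add_one, pow_succ, Matrix.trace]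
  simp [Matrix.mul_apply]

variable {V : Type*} [Fintype V] [DecidableEq V] (G : SimpleGraph V) [DecidableRel G.Adj] (D : ℕ)
variable [NeZero D] {R R' : Type*} [Fintype R] [DecidableEq R] [Fintype R'] [DecidableEq R']

/-- Outside A the field is trivial, so each replica traces out its own complement configuration;
inside A, τ links row and column indices. -/
theorem replicaSum_regionField (τ : Equiv.Perm R) (A : Finset V) (U : Sample G D) :
    replicaSum G D (regionField τ A) U = ∑ a : R → {x // x ∈ A} → Fin D,
      ∏ i, reducedDensity G D U A (a i) (a (τ i)) := by
  let e : ((R → {x // x ∈ A} → Fin D) × (R → {x // x ∉ A} → Fin D)) ≃ (R → V → Fin D) :=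
    (Equiv.arrowProdEquivProdArrow R _ _).symm.trans
      ((Equiv.refl R).arrowCongr (Equiv.piEquivPiSubtypeProd (· ∈ A) fun _ => Fin D).symm)
  have he : ∀ a b i, e (a, b) i = glue A (a i) (b i) := fun a b i => rfl
  rw [replicaSum, ← e.sum_comp, Fintype.sum_prod_type]
  refine Finset.sum_congr rfl fun a _ => ?_
  simp only [reducedDensity]
  rw [Fintype.prod_sum]
  refine Finset.sum_congr rfl fun b _ => ?_
  rw [← Finset.prod_mul_distrib]
  refine Finset.prod_congr rfl fun i _ => ?_
  congr 3
  funext x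
  simp only [he, glue, regionField]
  by_cases hx : x ∈ A <;> simp [hx]

theorem regionField_one (A : Finset V) :
    (regionField (1 : Equiv.Perm R) A) = fun _ => 1 := by
  funext x
  simp [regionField]

theorem replicaSum_finRotate {n : ℕ} (hn : n ≠ 0) (A : Finset V) (U : Sample G D) :
    replicaSum G D (regionField (finRotate n) A) U = ((reducedDensity G D U A) ^ n).trace := by
  rw [replicaSum_regionField, trace_pow_eq_sum_finRotate _ hn]

theorem replicaSum_one (n : ℕ) (A : Finset V) (U : Sample G D) :
    replicaSum G D (fun _ => (1 : Equiv.Perm (Fin n))) U =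
      ((reducedDensity G D U A).trace) ^ n := by
  rw [← regionField_one A, replicaSum_regionField, Matrix.trace, Fintype.sum_pow]
  rfl

/-- With h' = h this expresses the second moment as a first moment on doubled replicas. -/
theorem replicaSum_mul (h : V → Equiv.Perm R) (h' : V → Equiv.Perm R') (U : Sample G D) :
    replicaSum G D (fun x => Equiv.Perm.sumCongr (h x) (h' x)) U =
      replicaSum G D h U * replicaSum G D h' U := by
  rw [replicaSum, replicaSum, replicaSum, Finset.sum_mul_sum,
    ← (Equiv.sumArrowEquivProdArrow R R' (V → Fin D)).symm.sum_comp, Fintype.sum_prod_type]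
  refine Finset.sum_congr rfl fun p _ => Finset.sum_congr rfl fun p' _ => ?_
  rw [Fintype.prod_sum_type, Fintype.prod_sum_type, mul_mul_mul_comm]
  rfl

theorem reducedDensity_isHermitian (A : Finset V) (U : Sample G D) :
    (reducedDensity G D U A).IsHermitian := by
  ext a a'
  rw [Matrix.conjTranspose_apply, reducedDensity, reducedDensity, star_sum]
  refine Finset.sum_congr rfl fun b _ => ?_
  rw [star_mul', star_star, mul_comm]

theorem trace_pow_im (A : Finset V) (U : Sample G D) (n : ℕ) :
    (((reducedDensity G D U A) ^ n).trace).im = 0 := by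
  rw [← Complex.conj_eq_iff_im, ← Complex.star_def, ← Matrix.trace_conjTranspose,
    Matrix.conjTranspose_pow, (reducedDensity_isHermitian G D A U).eq]

end Traces

/-! ### Weights of aligned configurations -/

section Weights

variable {V : Type*} [Fintype V] [DecidableEq V] (G : SimpleGraph V) [DecidableRel G.Adj] (D : ℕ)
variable [NeZero D] {R : Type*} [Fintype R] [DecidableEq R]

theorem ascFactorial_pos' {N : ℕ} (hN : 0 < N) (m : ℕ) : 0 < N.ascFactorial m :=
  (pow_pos hN m).trans_le (Nat.pow_succ_le_ascFactorial N m)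

theorem ascFactorial_mono {N N' : ℕ} (h : N ≤ N') (m : ℕ) :
    N.ascFactorial m ≤ N'.ascFactorial m := by
  induction m with
  | zero => simp
  | succ m ih =>
    rw [Nat.ascFactorial_succ, Nat.ascFactorial_succ]
    gcongr

theorem weight_pos (h Γ : V → Equiv.Perm R) : 0 < weight G D h Γ := by
  have hD : 0 < D := NeZero.pos D
  have := fun x => ascFactorial_pos' (pow_pos hD (G.degree x + 1)) (Fintype.card R)
  unfold weight
  refine mul_pos (Finset.prod_pos fun x _ => ?_) (zpow_pos (by exact_mod_cast hD) _)
  exact div_pos (pow_pos (by exact_mod_cast hD) _) (by exact_mod_cast this x)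

theorem weight_eq_mul_excess (h Γ : V → Equiv.Perm R) :
    weight G D h Γ = weight G D h h * (D : ℝ) ^ (-excess G h Γ) := by
  have hD : (D : ℝ) ≠ 0 := NeZero.ne _
  rw [weight, weight, mul_assoc, ← zpow_add₀ hD]
  congr 2
  unfold excess
  ring

theorem permDist_sumCongr {ι : Type*} [Finite ι] (σ τ : Equiv.Perm ι) :
    permDist (Equiv.Perm.sumCongr σ σ) (Equiv.Perm.sumCongr τ τ) = 2 * permDist σ τ := by
  have h := permDist_add_orbitCount σ τ
  have h2 := permDist_add_orbitCount (Equiv.Perm.sumCongr σ σ) (Equiv.Perm.sumCongr τ τ)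
  rw [Equiv.Perm.sumCongr_inv, Equiv.Perm.sumCongr_mul, orbitCount_sumCongr, Nat.card_sum] at h2
  omega

theorem energy_sumCongr (h : V → Equiv.Perm R) :
    energy G (fun x => Equiv.Perm.sumCongr (h x) (h x))
      (fun x => Equiv.Perm.sumCongr (h x) (h x)) = 2 * energy G h h := by
  rw [energy_self, energy_self, Finset.mul_sum]
  refine Finset.sum_congr rfl fun e _ => ?_
  induction e using Sym2.ind with
  | _ x y => exact permDist_sumCongr (h x) (h y)

/-- Ground energies double exactly, and the normalization only helps: N(N+1)⋯(N+2m-1) is at least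
the square of N(N+1)⋯(N+m-1). -/
theorem weight_sumCongr_le (h : V → Equiv.Perm R) :
    weight G D (fun x => Equiv.Perm.sumCongr (h x) (h x))
      (fun x => Equiv.Perm.sumCongr (h x) (h x)) ≤ weight G D h h ^ 2 := by
  have hD : 0 < D := NeZero.pos D
  have hD' : (0 : ℝ) < D := by exact_mod_cast hD
  rw [weight, weight, energy_sumCongr, mul_pow, ← Finset.prod_pow]
  have h1 : (D : ℝ) ^ (-((2 * energy G h h : ℕ) : ℤ)) = ((D : ℝ) ^ (-(energy G h h : ℤ))) ^ 2 := by
    rw [← zpow_natCast, ← zpow_mul]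
    congr 1
    push_cast
    ring
  rw [h1]
  gcongr with x _
  have h2 := ascFactorial_pos' (pow_pos hD (G.degree x + 1)) (Fintype.card R)
  have h3 : (D ^ (G.degree x + 1)).ascFactorial (Fintype.card R) ^ 2 ≤
      (D ^ (G.degree x + 1)).ascFactorial (Fintype.card (R ⊕ R)) := by
    rw [Fintype.card_sum, ← Nat.ascFactorial_mul_ascFactorial, sq]
    exact Nat.mul_le_mul_left _ (ascFactorial_mono (Nat.le_add_right _ _) _)
  rw [div_pow, ← pow_mul, Fintype.card_sum, mul_two]
  rw [Fintype.card_sum] at h3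
  gcongr
  exact_mod_cast h3

end Weights

/-! ### The action and its ground state -/

section GroundState

variable {V : Type*} [Fintype V] [DecidableEq V] (G : SimpleGraph V) [DecidableRel G.Adj] (D : ℕ)
variable [NeZero D] {n : ℕ}

theorem action_eq (h Γ : V → Equiv.Perm (Fin n)) :
    action G D n h Γ = Real.log D * energy G h Γ - Real.log D * (n * Fintype.card V) +
      ∑ x, Real.log (normConst G D n x) := by
  have hc : ∀ σ τ : Equiv.Perm (Fin n),
      (cycleCount (σ⁻¹ * τ) : ℝ) = n - permDist σ τ := fun σ τ => by
    have h := permDist_add_orbitCount σ τ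
    rw [Nat.card_fin] at h
    have h' : (permDist σ τ : ℝ) + cycleCount (σ⁻¹ * τ) = n := by exact_mod_cast h
    linarith
  have h2 : 2 * (energy G h Γ : ℝ) = ∑ x, ∑ y ∈ G.neighborFinset x, (permDist (Γ x) (Γ y) : ℝ) +
      2 * ∑ x, (permDist (Γ x) (h x) : ℝ) := by exact_mod_cast two_mul_energy G h Γ
  unfold action
  simp only [hc, sub_sub_cancel_left, Finset.sum_neg_distrib, Finset.sum_sub_distrib,
    Finset.sum_const, Finset.card_univ, nsmul_eq_mul]
  linear_combination (-Real.log D / 2) * h2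

theorem exp_neg_action (h Γ : V → Equiv.Perm (Fin n)) :
    Real.exp (-action G D n h Γ) = weight G D h Γ := by
  have hD : 0 < D := NeZero.pos D
  have hD' : (0 : ℝ) < D := by exact_mod_cast hD
  have hlog : Real.log (weight G D h Γ) = -action G D n h Γ := by
    have hx : ∀ x, (0 : ℝ) < (D ^ (G.degree x + 1)).ascFactorial n := fun x => by
      exact_mod_cast ascFactorial_pos' (pow_pos hD (G.degree x + 1)) n
    rw [action_eq, weight, Fintype.card_fin, Real.log_mul
      (Finset.prod_pos fun x _ => div_pos (pow_pos hD' _) (hx x)).ne' (zpow_pos hD' _).ne',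
      Real.log_prod fun x _ => (div_pos (pow_pos hD' _) (hx x)).ne', Real.log_zpow]
    simp only [fun x => Real.log_div (pow_pos hD' n).ne' (hx x).ne', Finset.sum_sub_distrib,
      Real.log_pow, Finset.sum_const, Finset.card_univ, nsmul_eq_mul, normConst]
    push_cast
    ring
  rw [← hlog, Real.exp_log (weight_pos G D h Γ)]

theorem groundWeight_eq (h : V → Equiv.Perm (Fin n))
    (hmin : ∀ Γ : V → Equiv.Perm (Fin n), energy G h h ≤ energy G h Γ) :
    groundWeight G D n h = weight G D h h := by
  have hlog : 0 ≤ Real.log D := Real.log_natCast_nonneg D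
  have : minAction G D n h = action G D n h h := by
    refine le_antisymm (ciInf_le (Set.finite_range _).bddBelow h) (le_ciInf fun Γ => ?_)
    rw [action_eq, action_eq]
    have : (energy G h h : ℝ) ≤ energy G h Γ := by exact_mod_cast hmin Γ
    gcongr
  rw [groundWeight, this, exp_neg_action]

end GroundState

/-! ### Concentration of the replicated averages -/

section Concentration

/-- Centring at 1 instead of the mean means that a lower bound on E X suffices: E (X - 1)² = E X² -
2 E X + 1 ≤ b - 1. -/
theorem measure_deviation_le {Ω : Type*} [MeasurableSpace Ω] (μ : Measure Ω)
    [IsProbabilityMeasure μ] {X : Ω → ℝ} {b ε : ℝ} (hX : Integrable X μ)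
    (hX2 : Integrable (fun ω => X ω ^ 2) μ) (h1 : 1 ≤ ∫ ω, X ω ∂μ) (h2 : ∫ ω, X ω ^ 2 ∂μ ≤ b)
    (hε : 0 < ε) : μ.real {ω | ε ≤ |X ω - 1|} ≤ (b - 1) / ε ^ 2 := by
  have hsq : ∀ ω, (X ω - 1) ^ 2 = X ω ^ 2 - 2 * X ω + 1 := fun ω => by ring
  have hi : Integrable (fun ω => (X ω - 1) ^ 2) μ := by
    simp only [hsq]
    exact (hX2.sub (hX.const_mul 2)).add (integrable_const 1)
  have hint : ∫ ω, (X ω - 1) ^ 2 ∂μ ≤ b - 1 := by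
    simp only [hsq]
    rw [integral_add (f := fun ω => X ω ^ 2 - 2 * X ω) (hX2.sub (hX.const_mul 2))
        (integrable_const 1),
      integral_sub hX2 (hX.const_mul 2), integral_const_mul]
    simp
    linarith
  have hm := mul_meas_ge_le_integral_of_nonneg (μ := μ)
    (Filter.Eventually.of_forall fun ω => sq_nonneg (X ω - 1)) hi (ε ^ 2)
  have hset : {ω | ε ^ 2 ≤ (X ω - 1) ^ 2} = {ω | ε ≤ |X ω - 1|} := by
    ext ω
    rw [Set.mem_ofPred_eq, Set.mem_ofPred_eq, ← sq_abs (X ω - 1), sq_le_sq₀ hε.le (abs_nonneg _)]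
  rw [hset] at hm
  rw [le_div_iff₀ (by positivity)]
  linarith

variable {V : Type*} [Fintype V] [DecidableEq V] (G : SimpleGraph V) [DecidableRel G.Adj] (D : ℕ)
variable [NeZero D] {R : Type*} [Fintype R] [DecidableEq R]

theorem integral_re_replicaSum (h : V → Equiv.Perm R) :
    ∫ U, (replicaSum G D h U).re ∂sampleMeasure G D = ∑ Γ, weight G D h Γ := by
  have := integral_re (𝕜 := ℂ) (integrable_replicaSum G D h)
  rw [integral_replicaSum] at this
  simpa using this

/-- Deviation of a replicated average from its ground state value. -/
theorem replicaSum_deviation_le (τ : Equiv.Perm R) (A : Finset V) {θ : ℝ} (hθ0 : 0 ≤ θ)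
    (hθ : θ < 1) (hA : SmallSurface G θ A) {Δ : ℕ} (hΔ : ∀ x, G.degree x ≤ Δ)
    (hD : criticalDim (R ⊕ R) Δ (1 - θ) ≤ D ∨ IsEmpty V)
    (hreal : ∀ U, (replicaSum G D (regionField τ A) U).im = 0) {ε : ℝ} (hε : 0 < ε) :
    (sampleMeasure G D).real {U | ε ≤ |(replicaSum G D (regionField τ A) U).re /
      weight G D (regionField τ A) (regionField τ A) - 1|} ≤
      (Real.exp (criticalDim (R ⊕ R) Δ (1 - θ) * Fintype.card V / D) - 1) / ε ^ 2 := by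
  have : IsProbabilityMeasure (sampleMeasure G D) := by
    unfold sampleMeasure
    infer_instance
  set h : V → Equiv.Perm R := regionField τ A with hh
  set g := weight G D h h with hg
  have hg0 : 0 < g := weight_pos G D h h
  let h2 : V → Equiv.Perm (R ⊕ R) := fun x => Equiv.Perm.sumCongr (h x) (h x)
  have hh2 : h2 = regionField (Equiv.Perm.sumCongr τ τ) A := by
    funext x
    by_cases hx : x ∈ A
    · simp [h2, hh, regionField, hx]
    · simp [h2, hh, regionField, hx, Equiv.Perm.sumCongr_one]
  -- Reality of the replica sum enters here: the real part of a square is the square of the real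
  -- part only when the imaginary part vanishes.
  have hsq : ∀ U, ((replicaSum G D h U).re / g) ^ 2 = (replicaSum G D h2 U).re / g ^ 2 := by
    intro U
    rw [replicaSum_mul, Complex.mul_re, hreal U]
    ring
  refine measure_deviation_le _ ((integrable_replicaSum G D h).re.div_const g) ?_ ?_ ?_ hε
  · simp only [hsq]
    exact (integrable_replicaSum G D h2).re.div_const _
  · rw [integral_div, integral_re_replicaSum, le_div_iff₀ hg0, one_mul]
    exact Finset.single_le_sum (f := fun Γ => weight G D h Γ)
      (fun Γ _ => (weight_pos G D h Γ).le) (Finset.mem_univ h)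
  · simp only [hsq]
    rw [integral_div, integral_re_replicaSum, div_le_iff₀ (by positivity)]
    have hsum : ∑ Γ : V → Equiv.Perm (R ⊕ R), (D : ℝ) ^ (-excess G h2 Γ) ≤
        Real.exp (criticalDim (R ⊕ R) Δ (1 - θ) * Fintype.card V / D) := by
      rcases hD with hD | hV
      · exact sum_excess_weight_le G hΔ h2 (by linarith)
          (fun Γ => by rw [hh2]; exact energy_gap G hθ0 hA _ Γ) hD
      · rw [Fintype.sum_subsingleton _ h2]
        simp [excess]
    rw [Finset.sum_congr rfl fun Γ _ => weight_eq_mul_excess G D h2 Γ, ← Finset.mul_sum,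
      mul_comm (Real.exp _)]
    exact (mul_le_mul_of_nonneg_left hsum (weight_pos G D h2 h2).le).trans
      (mul_le_mul_of_nonneg_right (weight_sumCongr_le G D h) (Real.exp_nonneg _))

/-- The lower bound needs (1 - δ/4)(1 + δ/2) ≥ 1, which for positive δ means exactly δ ≤ 2. -/
theorem abs_log_le_of_near_one {X δ : ℝ} (hδ0 : 0 < δ) (hδ : δ ≤ 2) (hX : |X - 1| < δ / 4) :
    0 < X ∧ |Real.log X| ≤ δ / 2 := by
  rw [abs_lt] at hX
  have hX0 : 0 < X := by linarith
  refine ⟨hX0, abs_le.2 ⟨?_, ?_⟩⟩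
  · have h := Real.one_sub_inv_le_log_of_pos hX0
    have h2 : X⁻¹ ≤ 1 + δ / 2 := by
      rw [inv_le_iff_one_le_mul₀ hX0]
      nlinarith
    linarith
  · have := Real.log_le_sub_one_of_pos hX0
    linarith

end Concentration

end RandomPEPS

end

/-! ### Assembly of the fluctuation bound. -/

theorem mainTheorem3 (n Δ : ℕ) (hn : 2 ≤ n) (θ : ℝ) (hθ : θ < 1) :
    ∃ c : ℝ, 0 < c ∧
      ∀ {V : Type*} [Fintype V] [DecidableEq V] (G : SimpleGraph V) [DecidableRel G.Adj],
        (∀ x, G.degree x ≤ Δ) →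
        ∀ (D : ℕ) [NeZero D] (A : Finset V), RandomPEPS.SmallSurface G θ A →
        ∀ δ : ℝ, 0 < δ → δ ≤ 2 →
          1 - 32 / δ ^ 2 * (Real.exp (c * Fintype.card V / D) - 1) ≤
            (RandomPEPS.sampleMeasure G D).real
              {U | |RandomPEPS.renyiEntropy G D U A n - RandomPEPS.renyiEntropyInf G D n A| ≤ δ} := by
  open RandomPEPS in
  -- A negative θ is raised to 0, so that `energy_gap` applies and the empty region, used for the
  -- denominator, also satisfies the surface condition.
  set θ' : ℝ := max θ 0 with hθ'
  have hθ0 : 0 ≤ θ' := le_max_right _ _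
  have hθ1 : θ' < 1 := max_lt hθ one_pos
  set c := criticalDim (Fin n ⊕ Fin n) Δ (1 - θ') with hc
  have hc1 : 1 ≤ c := one_le_criticalDim Δ (by linarith)
  refine ⟨c, by linarith, fun {V} _ _ G _ hΔ D _ A hA δ hδ0 hδ => ?_⟩
  have hDpos : (0 : ℝ) < D := by exact_mod_cast NeZero.pos D
  have hprob : IsProbabilityMeasure (sampleMeasure G D) := by
    unfold sampleMeasure
    infer_instance
  -- An empty graph belongs to the main case: there the error term is 0, so the bound is not vacuous
  -- even for small D.
  by_cases hD : c ≤ D ∨ IsEmpty V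
  · have hA1 : SmallSurface G θ' A := fun B =>
      (hA B).trans (mul_le_mul_of_nonneg_right (le_max_left _ _) (Nat.cast_nonneg _))
    have hA0 : SmallSurface G θ' (∅ : Finset V) := fun B => by
      have : surface G (∅ : Finset V) = 0 := by simp [surface, SimpleGraph.interedges_empty_left]
      rw [this, Nat.cast_zero, zero_sub]
      exact (neg_nonpos.2 (Nat.cast_nonneg _)).trans (mul_nonneg hθ0 (Nat.cast_nonneg _))
    have hn0 : n ≠ 0 := by omega
    have hmin : ∀ (τ : Equiv.Perm (Fin n)) (B : Finset V), SmallSurface G θ' B →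
        groundWeight G D n (regionField τ B) =
          weight G D (regionField τ B) (regionField τ B) := by
      intro τ B hB
      refine groundWeight_eq G D _ fun Γ => ?_
      have h1 := energy_gap G hθ0 hB τ Γ
      have h2 : (0 : ℝ) ≤ (1 - θ') * ∑ x, (permDist (Γ x) (regionField τ B x) : ℝ) :=
        mul_nonneg (by linarith) (by positivity)
      have h3 : (energy G (regionField τ B) (regionField τ B) : ℝ) ≤
        energy G (regionField τ B) Γ := by linarith
      exact_mod_cast h3
    have hb1 : boundaryField n A = regionField (finRotate n) A := rfl
    have hb0 : (fun _ : V => (1 : Equiv.Perm (Fin n))) = regionField 1 ∅ :=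
      (regionField_one ∅).symm
    have hz1 : ∀ U, replicaSum G D (regionField (finRotate n) A) U =
      ((reducedDensity G D U A) ^ n).trace := replicaSum_finRotate G D hn0 A
    have hz0 : ∀ U, replicaSum G D (regionField (1 : Equiv.Perm (Fin n)) ∅) U =
        ((reducedDensity G D U A).trace) ^ n := fun U => by
      rw [← hb0]
      exact replicaSum_one G D n A U
    have hr1 : ∀ U, (replicaSum G D (regionField (finRotate n) A) U).im = 0 := fun U => by
      rw [hz1]
      exact trace_pow_im G D A U n
    have hr0 : ∀ U, (replicaSum G D (regionField (1 : Equiv.Perm (Fin n)) ∅) U).im = 0 :=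
        fun U => by
      have h1 := trace_pow_im G D A U 1
      rw [pow_one, ← Complex.conj_eq_iff_im] at h1
      rw [hz0, ← Complex.conj_eq_iff_im, map_pow, h1]
    have hd1 := replicaSum_deviation_le G D (finRotate n) A hθ0 hθ1 hA1 hΔ hD hr1
      (ε := δ / 4) (by linarith)
    have hd0 := replicaSum_deviation_le G D (1 : Equiv.Perm (Fin n)) ∅ hθ0 hθ1 hA0 hΔ hD hr0
      (ε := δ / 4) (by linarith)
    set g1 := weight G D (regionField (finRotate n) A) (regionField (finRotate n) A) with hg1
    set g0 := weight G D (regionField (1 : Equiv.Perm (Fin n)) (∅ : Finset V))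
      (regionField 1 ∅) with hg0
    have hg1p : 0 < g1 := weight_pos G D _ _
    have hg0p : 0 < g0 := weight_pos G D _ _
    set S1 := {U : Sample G D | δ / 4 ≤
      |(replicaSum G D (regionField (finRotate n) A) U).re / g1 - 1|} with hS1
    set S0 := {U : Sample G D | δ / 4 ≤
      |(replicaSum G D (regionField (1 : Equiv.Perm (Fin n)) ∅) U).re / g0 - 1|} with hS0
    -- Covering the whole space and using subadditivity avoids any measurability question about the
    -- good event.
    have hcover : (Set.univ : Set (Sample G D)) ⊆
        {U | |renyiEntropy G D U A n - renyiEntropyInf G D n A| ≤ δ} ∪ (S1 ∪ S0) := by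
      intro U _
      by_cases hU1 : U ∈ S1
      · exact Or.inr (Or.inl hU1)
      by_cases hU0 : U ∈ S0
      · exact Or.inr (Or.inr hU0)
      refine Or.inl ?_
      rw [hS1, Set.mem_ofPred_eq, not_le] at hU1
      rw [hS0, Set.mem_ofPred_eq, not_le] at hU0
      obtain ⟨hX, hlX⟩ := abs_log_le_of_near_one hδ0 hδ hU1
      obtain ⟨hY, hlY⟩ := abs_log_le_of_near_one hδ0 hδ hU0
      set r1 := (replicaSum G D (regionField (finRotate n) A) U).re with hrr1
      set r0 := (replicaSum G D (regionField (1 : Equiv.Perm (Fin n)) ∅) U).re with hrr0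
      have e1 : ((reducedDensity G D U A) ^ n).trace = (r1 : ℂ) := by
        rw [← hz1]
        exact Complex.ext rfl (hr1 U)
      have e0 : ((reducedDensity G D U A).trace) ^ n = (r0 : ℂ) := by
        rw [← hz0]
        exact Complex.ext rfl (hr0 U)
      have hr1p : 0 < r1 := (div_pos_iff_of_pos_right hg1p).1 hX
      have hr0p : 0 < r0 := (div_pos_iff_of_pos_right hg0p).1 hY
      rw [Set.mem_ofPred_eq, renyiEntropy, renyiEntropyInf, e1, e0, hb1, hb0, hmin _ _ hA1,
        hmin _ _ hA0, ← Complex.ofReal_div, Complex.ofReal_re, ← mul_sub, abs_mul,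
        Real.log_div hr1p.ne' hr0p.ne', Real.log_div hg1p.ne' hg0p.ne']
      rw [Real.log_div hr1p.ne' hg1p.ne'] at hlX
      rw [Real.log_div hr0p.ne' hg0p.ne'] at hlY
      have hn1 : |1 / (1 - (n : ℝ))| ≤ 1 := by
        have : (2 : ℝ) ≤ n := by exact_mod_cast hn
        rw [abs_div, abs_one, abs_of_neg (by linarith), div_le_one (by linarith)]
        linarith
      have habs : |Real.log r1 - Real.log r0 - (Real.log g1 - Real.log g0)| ≤ δ := by
        rw [abs_le] at hlX hlY ⊢
        constructor <;> linarith [hlX.1, hlX.2, hlY.1, hlY.2]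
      calc _ ≤ 1 * |Real.log r1 - Real.log r0 - (Real.log g1 - Real.log g0)| := by gcongr
        _ ≤ δ := by rw [one_mul]; exact habs
    have hm := (measureReal_mono (μ := sampleMeasure G D) hcover).trans
      ((measureReal_union_le _ _).trans (add_le_add_right (measureReal_union_le _ _) _))
    rw [probReal_univ] at hm
    have hfin : 32 / δ ^ 2 * (Real.exp (c * Fintype.card V / D) - 1) =
        (Real.exp (c * Fintype.card V / D) - 1) / (δ / 4) ^ 2 +
          (Real.exp (c * Fintype.card V / D) - 1) / (δ / 4) ^ 2 := by
      field_simp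
      ring
    linarith
  -- Below the critical dimension cV/D ≥ 1, so the exponential minus 1 is at least 1, while 32/δ² ≥
  -- 8. The claimed lower bound is then at most 0.
  · push Not at hD
    obtain ⟨hDc, hV⟩ := hD
    have hV1 : (1 : ℝ) ≤ Fintype.card V := by exact_mod_cast Fintype.card_pos
    have h1 : 1 ≤ c * Fintype.card V / D := by
      rw [le_div_iff₀ hDpos]
      nlinarith
    have h2 : 1 ≤ Real.exp (c * Fintype.card V / D) - 1 := by
      have := Real.add_one_le_exp (c * Fintype.card V / D)
      linarith
    have h3 : 1 ≤ 32 / δ ^ 2 := by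
      rw [le_div_iff₀ (by positivity)]
      nlinarith
    have h4 : 1 ≤ 32 / δ ^ 2 * (Real.exp (c * Fintype.card V / D) - 1) := by nlinarith
    exact (sub_nonpos.2 h4).trans measureReal_nonneg
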